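/- Let $K$ be a field. A \emph{Brauer graph} is a finite graph (loops and multiple edges allowed, not necessarily connected) with a multiplicity $\mathfrak m(v)\in\mathbb Z_{>0}$ for every vertex $v$ and a cyclic order $\mathfrak o(v)$ of the half-edges at every vertex $v$; the valency $\mathrm{val}(v)$ is the number of half-edges at $v$. A \emph{skew-Brauer graph} $\Gamma^\times$ is a Brauer graph with a set of \emph{distinguished} vertices, each with $\mathfrak m(v)=\mathrm{val}(v)=1$ and adjacent to a vertex that is not distinguished; the edges at distinguished vertices are the distinguished edges. The quiver $Q$ has the edges of $\Gamma^\times$ as vertices and, for every half-edge $h$ at a vertex $v$ with $\mathfrak m(v)\mathrm{val}(v)\ge 2$, an arrow $\alpha_h$ from the edge of $h$ to the edge of the immediate successor of $h$ in $\mathfrak o(v)$. Going once around $v$ gives the special cycle $C_v$ (up to cyclic permutation). Assume that $Q$ has no loop at a distinguished edge. The quiver $Q^{sg}$ is obtained by replacing every distinguished edge $x$ by two vertices $x^+,x^-$ (other edges $x$ give one vertex $x$, with empty sign $\emptyset$), and every arrow $\alpha:x\to y$ by the arrows ${}^{\varepsilon}\alpha^{\varepsilon'}:x^{\varepsilon}\to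 y^{\varepsilon'}$ for all possible signs. The sg-special cycles $C_{v,l}$ at $v$ are the closed paths of $Q^{sg}$ (up to cyclic permutation) lying over $C_v$. Let $I_{\Gamma^\times}\subset KQ^{sg}$ be the two-sided ideal generated by \begin{itemize} \item (0) $({}^{\varepsilon}\alpha^{+})({}^{+}\beta^{\varepsilon'})-({}^{\varepsilon}\alpha^{-})({}^{-}\beta^{\varepsilon'})$; \item (I) $C_{v,l}^{\mathfrak m(v)}-C_{v',l'}^{\mathfrak m(v')}$ for sg-special cycles starting at the same vertex of $Q^{sg}$; \item (IIa) $C_{v,l}^{\mathfrak m(v)}\alpha$, with $\alpha$ the first arrow of $C_{v,l}$; \item (IIb) $C_{v,l}^{\mathfrak m(v)-1}({}^{\varepsilon_1}\alpha_1^{\varepsilon_2})\cdots({}^{\varepsilon_r}\alpha_r^{\varepsilon_{r+1}})$ for each special cycle $C_v=\alpha_1\cdots\alpha_r$ starting at a distinguished edge, where $C_{v,l}$ lies over $\alpha_1\cdots\alpha_r$ and starts at the sign $\varepsilon_1$, and $\varepsilon_1\ne\varepsilon_{r+1}$; \item (III) the paths $\alpha\beta$ of length two that are not sub-paths of any sg-special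 cycle, except when $\alpha=\beta$ is a loop coming from a vertex $v$ with $\mathrm{val}(v)=1$ and $\mathfrak m(v)>1$. \end{itemize} Then the skew-Brauer graph algebra $B_{\Gamma^\times}=KQ^{sg}/I_{\Gamma^\times}$ is finite dimensional over $K$. It is moreover a symmetric algebra (there is a linear form $\varphi:B_{\Gamma^\times}\to K$ with $\varphi(ab)=\varphi(ba)$ such that $(a,b)\mapsto\varphi(ab)$ is nondegenerate), for an arbitrary multiplicity function $\mathfrak m$, with the exception of the following degenerate configuration, which is excluded: a vertex $v$ with $\mathrm{val}(v)=2$ and $\mathfrak m(v)>1$, one of whose two edges is distinguished while the other edge joins $v$ to a vertex $u$ with $\mathfrak m(u)\,\mathrm{val}(u)\neq 1$. -/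

import Mathlib

noncomputable section

/-! ## The path algebra of a quiver -/

/-- The paths of a quiver, with their start and their end; `⟨x, x, Path.nil⟩` is the stationary
path at `x`. -/
def TotalPath (Q : Type*) [Quiver Q] : Type _ := Σ x y : Q, Quiver.Path x y

namespace TotalPath

variable {Q : Type*} [Quiver Q]

/-- A path from `x` to `y`, as a member of the type of all paths. -/
def mk {x y : Q} (p : Quiver.Path x y) : TotalPath Q := ⟨x, y, p⟩

/-- The stationary path at `x`. -/
def stationary (x : Q) : TotalPath Q := mk (Quiver.Path.nil : Quiver.Path x x)

open Classical in
/-- Concatenation `pq` (first `p`, then `q`) when `p` ends where `q` starts, and `none` otherwise. -/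
def comp : TotalPath Q → TotalPath Q → Option (TotalPath Q)
  | ⟨x, y, p⟩, ⟨y', z, q⟩ => if h : y = y' then some ⟨x, z, p.comp (h ▸ q)⟩ else none

theorem comp_mk {x y z : Q} (p : Quiver.Path x y) (q : Quiver.Path y z) :
    comp (mk p) (mk q) = some (mk (p.comp q)) := by
  simp [comp, mk]

theorem comp_mk_of_ne {x y y' z : Q} (h : y ≠ y') (p : Quiver.Path x y) (q : Quiver.Path y' z) :
    comp (mk p) (mk q) = none := by
  simp [comp, mk, h]

end TotalPath

/-- The path algebra `KQ`: the vector space with basis the paths of `Q`. -/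
def PathAlgebra (K Q : Type*) [Field K] [Quiver Q] : Type _ := TotalPath Q →₀ K

namespace PathAlgebra

variable {K Q : Type*} [Field K] [Quiver Q]

instance : AddCommGroup (PathAlgebra K Q) := inferInstanceAs (AddCommGroup (TotalPath Q →₀ K))

instance : Module K (PathAlgebra K Q) := inferInstanceAs (Module K (TotalPath Q →₀ K))

/-- The basis of the path algebra that consists of the paths. -/
def basis : Module.Basis (TotalPath Q) K (PathAlgebra K Q) := ⟨LinearEquiv.refl K _⟩

/-- The basis element given by a path. -/
def single (p : TotalPath Q) : PathAlgebra K Q := basis p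

/-- The basis element given by a path from `x` to `y`. -/
def ofPath {x y : Q} (p : Quiver.Path x y) : PathAlgebra K Q := single (TotalPath.mk p)

/-- The basis element given by a path, or zero. -/
def ofOption : Option (TotalPath Q) → PathAlgebra K Q
  | none => 0
  | some p => single p

/-- The product of the path algebra: the bilinear extension of the concatenation of paths. -/
def mulLinear : PathAlgebra K Q →ₗ[K] PathAlgebra K Q →ₗ[K] PathAlgebra K Q :=
  basis.constr K fun p => basis.constr K fun q => ofOption (TotalPath.comp p q)

instance : Mul (PathAlgebra K Q) := ⟨fun a b => mulLinear a b⟩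

/-- The unit of the path algebra: the sum of the stationary paths. -/
instance [Finite Q] : One (PathAlgebra K Q) :=
  ⟨letI := Fintype.ofFinite Q; ∑ x : Q, single (TotalPath.stationary x)⟩

theorem mul_def (a b : PathAlgebra K Q) : a * b = mulLinear a b := rfl

theorem single_mul_single (p q : TotalPath Q) :
    (single p * single q : PathAlgebra K Q) = ofOption (TotalPath.comp p q) := by
  simp only [mul_def, mulLinear, single, Module.Basis.constr_basis]

theorem hom_ext {M : Type*} [AddCommMonoid M] [Module K M] {f g : PathAlgebra K Q →ₗ[K] M}
    (h : ∀ p, f (single p) = g (single p)) : f = g :=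
  basis.ext h

theorem ofPath_mul_ofPath {x y z : Q} (p : Quiver.Path x y) (q : Quiver.Path y z) :
    (ofPath p * ofPath q : PathAlgebra K Q) = ofPath (p.comp q) := by
  rw [ofPath, ofPath, single_mul_single, TotalPath.comp_mk]; rfl

theorem ofPath_mul_ofPath_of_ne {x y y' z : Q} (h : y ≠ y')
    (p : Quiver.Path x y) (q : Quiver.Path y' z) :
    (ofPath p * ofPath q : PathAlgebra K Q) = 0 := by
  rw [ofPath, ofPath, single_mul_single, TotalPath.comp_mk_of_ne h]; rfl

theorem zero_mul' (a : PathAlgebra K Q) : 0 * a = 0 := by simp [mul_def]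

theorem mul_zero' (a : PathAlgebra K Q) : a * 0 = 0 := by simp [mul_def]

theorem mul_assoc_single (p q r : TotalPath Q) :
    (single p * single q * single r : PathAlgebra K Q) = single p * (single q * single r) := by
  obtain ⟨x, y, p⟩ := p
  obtain ⟨y', z, q⟩ := q
  obtain ⟨z', w, r⟩ := r
  change (ofPath p * ofPath q * ofPath r : PathAlgebra K Q) = ofPath p * (ofPath q * ofPath r)
  by_cases h : y = y'
  · subst h
    by_cases h' : z = z'
    · subst h'
      simp only [ofPath_mul_ofPath, Quiver.Path.comp_assoc]
    · rw [ofPath_mul_ofPath, ofPath_mul_ofPath_of_ne h', ofPath_mul_ofPath_of_ne h', mul_zero']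
  · rw [ofPath_mul_ofPath_of_ne h, zero_mul']
    by_cases h' : z = z'
    · subst h'
      rw [ofPath_mul_ofPath, ofPath_mul_ofPath_of_ne h]
    · rw [ofPath_mul_ofPath_of_ne h', mul_zero']

theorem mul_assoc' (a b c : PathAlgebra K Q) : a * b * c = a * (b * c) := by
  have key : (mulLinear (K := K) (Q := Q)).compr₂ mulLinear =
      ((LinearMap.llcomp K (PathAlgebra K Q) (PathAlgebra K Q) (PathAlgebra K Q)).compl₂
        mulLinear).comp mulLinear := by
    refine hom_ext fun p => hom_ext fun q => hom_ext fun r => ?_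
    exact mul_assoc_single p q r
  exact LinearMap.congr_fun (LinearMap.congr_fun (LinearMap.congr_fun key a) b) c

theorem one_def [Fintype Q] :
    (1 : PathAlgebra K Q) = ∑ x : Q, ofPath (Quiver.Path.nil : Quiver.Path x x) := by
  change (letI := Fintype.ofFinite Q; ∑ x : Q, single (TotalPath.stationary x)) = _
  rw [Subsingleton.elim (Fintype.ofFinite Q) ‹Fintype Q›]
  rfl

theorem one_mul' [Finite Q] (a : PathAlgebra K Q) : 1 * a = a := by
  have := Fintype.ofFinite Q
  have key : mulLinear (1 : PathAlgebra K Q) = LinearMap.id := by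
    refine hom_ext fun p => ?_
    obtain ⟨x, y, p⟩ := p
    change mulLinear 1 (ofPath p) = ofPath p
    rw [one_def, map_sum, LinearMap.sum_apply, Finset.sum_eq_single x]
    · rw [← mul_def, ofPath_mul_ofPath, Quiver.Path.nil_comp]
    · intro z _ hz
      rw [← mul_def, ofPath_mul_ofPath_of_ne hz]
    · simp
  exact LinearMap.congr_fun key a

theorem mul_one' [Finite Q] (a : PathAlgebra K Q) : a * 1 = a := by
  have := Fintype.ofFinite Q
  have key : (mulLinear (K := K) (Q := Q)).flip 1 = LinearMap.id := by
    refine hom_ext fun p => ?_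
    obtain ⟨x, y, p⟩ := p
    change mulLinear (ofPath p) 1 = ofPath p
    rw [one_def, map_sum, Finset.sum_eq_single y]
    · rw [← mul_def, ofPath_mul_ofPath, Quiver.Path.comp_nil]
    · intro z _ hz
      rw [← mul_def, ofPath_mul_ofPath_of_ne (Ne.symm hz)]
    · simp
  exact LinearMap.congr_fun key a

instance [Finite Q] : Ring (PathAlgebra K Q) where
  __ := (inferInstance : AddCommGroup (PathAlgebra K Q))
  left_distrib a b c := by simp [mul_def]
  right_distrib a b c := by simp [mul_def]
  zero_mul := zero_mul'
  mul_zero := mul_zero'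
  mul_assoc := mul_assoc'
  one_mul := one_mul'
  mul_one := mul_one'

instance [Finite Q] : Algebra K (PathAlgebra K Q) :=
  Algebra.ofModule (fun r a b => by simp [mul_def]) (fun r a b => by simp [mul_def])

end PathAlgebra

/-! ## Symmetric algebras -/

/-- A finite dimensional `K`-algebra `A` is symmetric when it has a symmetrizing form: a linear
form `φ` with `φ (ab) = φ (ba)` such that the bilinear form `(a, b) ↦ φ (ab)` is nondegenerate.
Equivalently, `A` and its dual space are isomorphic as `A`-`A`-bimodules. -/
def IsSymmetricFiniteDimensionalAlgebra (K A : Type*) [Field K] [Ring A] [Algebra K A] : Prop :=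
  FiniteDimensional K A ∧
    ∃ φ : A →ₗ[K] K, (∀ a b, φ (a * b) = φ (b * a)) ∧ ∀ a, (∀ b, φ (a * b) = 0) → a = 0

/-! ## The sg-quiver -/

/-- The vertices of the sg-quiver of a quiver `Q` with a set `Sp` of distinguished vertices: a
distinguished vertex `x` gives `x⁺` (sign `some true`) and `x⁻` (sign `some false`), any other
vertex `x` gives only `x` (sign `none`). -/
@[ext]
structure SgVertex {Q : Type*} (Sp : Set Q) where
  /-- the underlying vertex of `Q` -/
  vertex : Q
  /-- the sign -/
  sign : Option Bool
  sign_isSome : sign.isSome ↔ vertex ∈ Sp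

namespace SgVertex

instance {Q : Type*} [Finite Q] (Sp : Set Q) : Finite (SgVertex Sp) :=
  Finite.of_injective (fun x : SgVertex Sp => (x.vertex, x.sign)) fun x y h => by
    simp only [Prod.mk.injEq] at h
    exact SgVertex.ext h.1 h.2

/-- The arrows `(x, α, y)` of the sg-quiver: one for each arrow `α` of `Q` from the vertex under
`x` to the vertex under `y`. -/
instance {Q : Type*} [Quiver Q] (Sp : Set Q) : Quiver (SgVertex Sp) :=
  ⟨fun x y => x.vertex ⟶ y.vertex⟩

end SgVertex

/-! ## Skew-Brauer graphs -/

/-- A Brauer graph with vertex set `V` and edge set `E` (loops and multiple edges are allowed).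
Every edge `e` has the two ends (half-edges) `(e, true)` and `(e, false)`. -/
structure BrauerGraph (V E : Type*) where
  /-- the vertex to which an end of an edge is attached -/
  endpoint : E × Bool → V
  /-- the multiplicity function -/
  mult : V → ℕ
  mult_pos : ∀ v, 0 < mult v
  /-- the orientation: the immediate successor of a half-edge in the cyclic order at its vertex -/
  next : Equiv.Perm (E × Bool)
  endpoint_next : ∀ h, endpoint (next h) = endpoint h
  sameCycle_next : ∀ h h', endpoint h = endpoint h' → next.SameCycle h h'

namespace BrauerGraph

variable {V E : Type*} (Γ : BrauerGraph V E)

/-- The valency of a vertex (a loop counts twice). -/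
def val (v : V) : ℕ := Nat.card {h : E × Bool // Γ.endpoint h = v}

/-- The other end of the same edge. -/
def opp (h : E × Bool) : E × Bool := (h.1, !h.2)

/-- The vertices of the Brauer quiver: the edges of the Brauer graph. -/
def QuiverVertex (_Γ : BrauerGraph V E) : Type _ := E

instance [Finite E] : Finite Γ.QuiverVertex := inferInstanceAs (Finite E)

/-- The arrows `x ⟶ y` of the Brauer quiver: one for every end `half` of `x` whose immediate
successor is an end of `y`. There is no arrow at a vertex `v` with `val v = 1` and `mult v = 1`. -/
@[ext]
structure Arrow (x y : Γ.QuiverVertex) where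
  /-- the half-edge where the arrow starts -/
  half : E × Bool
  source_eq : half.1 = x
  target_eq : (Γ.next half).1 = y
  nontrivial : 2 ≤ Γ.mult (Γ.endpoint half) * Γ.val (Γ.endpoint half)

instance : Quiver Γ.QuiverVertex := ⟨Γ.Arrow⟩

/-- The special cycle at the vertex of `h`, starting with the arrow given by `h`, as the list of
its arrows (an arrow is determined by the half-edge where it starts). -/
def specialCycle (h : E × Bool) : List (E × Bool) :=
  (List.range (Γ.val (Γ.endpoint h))).map fun i => (Γ.next ^ i) h

end BrauerGraph

/-- A skew-Brauer graph: a Brauer graph with a set of distinguished vertices, each of them of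
multiplicity one and of valency one, and adjacent to a vertex that is not distinguished. -/
structure SkewBrauerGraph (V E : Type*) extends BrauerGraph V E where
  /-- the set of distinguished vertices -/
  distinguished : Set V
  mult_distinguished : ∀ v ∈ distinguished, mult v = 1
  val_distinguished : ∀ v ∈ distinguished, toBrauerGraph.val v = 1
  endpoint_opp : ∀ h, endpoint h ∈ distinguished → endpoint (BrauerGraph.opp h) ∉ distinguished

namespace SkewBrauerGraph

variable {V E : Type*} (Γ : SkewBrauerGraph V E)

/-- The distinguished edges, which are the distinguished vertices of the skew-Brauer quiver. -/
def Sp : Set Γ.QuiverVertex :=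
  {x | ∃ h : E × Bool, h.1 = x ∧ Γ.endpoint h ∈ Γ.distinguished}

/-- (The vertices of) the admissible skew-Brauer quiver: the sg-quiver of the Brauer quiver. -/
abbrev SgQuiver : Type _ := SgVertex Γ.Sp

variable {Γ}

/-- The half-edge that gives an arrow of the admissible skew-Brauer quiver. -/
def half {x y : Γ.SgQuiver} (α : x ⟶ y) : E × Bool :=
  BrauerGraph.Arrow.half (Γ := Γ.toBrauerGraph) (x := x.vertex) (y := y.vertex) α

/-- The half-edges that give the arrows of a path, in their order along the path. -/
def halves {x : Γ.SgQuiver} : {y : Γ.SgQuiver} → Quiver.Path x y → List (E × Bool)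
  | _, .nil => []
  | _, .cons p α => halves p ++ [half α]

/-- `C` is an sg-special cycle at the vertex of `h`, starting with an arrow given by `h`: a cycle
of the admissible skew-Brauer quiver that lies over the special cycle starting with `h`. -/
def IsSgSpecialCycle (h : E × Bool) {y : Γ.SgQuiver} (C : Quiver.Path y y) : Prop :=
  halves C = Γ.specialCycle h

/-- `p` is a sub-path of an sg-special cycle (sg-special cycles being taken up to cyclic
permutation, that is, with all their possible starting points). -/
def IsSubpathOfSgSpecialCycle {x z : Γ.SgQuiver} (p : Quiver.Path x z) : Prop :=
  ∃ (h : E × Bool) (y : Γ.SgQuiver) (C : Quiver.Path y y), IsSgSpecialCycle h C ∧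
    ∃ (a : Quiver.Path y x) (b : Quiver.Path z y), C = (a.comp p).comp b

/-- `αβ` is the square of a loop `α = β` induced by a vertex `v` with `val v = 1` and
`mult v > 1`. -/
def IsSquareOfLoop {x y z : Γ.SgQuiver} (α : x ⟶ y) (β : y ⟶ z) : Prop :=
  x = y ∧ y = z ∧ half α = half β ∧
    Γ.val (Γ.endpoint (half α)) = 1 ∧ 1 < Γ.mult (Γ.endpoint (half α))

variable (Γ)

open PathAlgebra in
/-- The relations that generate the ideal of the skew-Brauer graph algebra. -/
inductive Relation (K : Type*) [Field K] [Finite E] : PathAlgebra K Γ.SgQuiver → Prop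
  /-- Type 0: `(ᵋα⁺)(⁺βᵋ') - (ᵋα⁻)(⁻βᵋ')`. -/
  | type0 {x y y' z : Γ.SgQuiver} (αp : x ⟶ y) (βp : y ⟶ z) (αm : x ⟶ y') (βm : y' ⟶ z)
      (hα : half αp = half αm) (hβ : half βp = half βm)
      (hy : y.sign = some true) (hy' : y'.sign = some false) :
      Relation K (ofPath (αp.toPath.comp βp.toPath) - ofPath (αm.toPath.comp βm.toPath))
  /-- Type I: the difference of the powers of two sg-special cycles that start at the same
  vertex. -/
  | typeI {y : Γ.SgQuiver} (h h' : E × Bool) (C C' : Quiver.Path y y)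
      (hC : IsSgSpecialCycle h C) (hC' : IsSgSpecialCycle h' C') :
      Relation K (ofPath C ^ Γ.mult (Γ.endpoint h) - ofPath C' ^ Γ.mult (Γ.endpoint h'))
  /-- Type IIa: the power of an sg-special cycle, followed by the first arrow of that cycle. -/
  | typeIIa {y z : Γ.SgQuiver} (h : E × Bool) (C : Quiver.Path y y) (hC : IsSgSpecialCycle h C)
      (α : y ⟶ z) (p : Quiver.Path z y) (hα : C = α.toPath.comp p) :
      Relation K (ofPath C ^ Γ.mult (Γ.endpoint h) * ofPath α.toPath)
  /-- Type IIb: the power with exponent `mult v - 1` of an sg-special cycle that starts at `x⁺` or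
  `x⁻`, followed by a path over the same special cycle which ends at the opposite sign. -/
  | typeIIb {y y' : Γ.SgQuiver} (h : E × Bool) (C : Quiver.Path y y) (hC : IsSgSpecialCycle h C)
      (hy : y.vertex ∈ Γ.Sp) (p : Quiver.Path y y') (hp : halves p = Γ.specialCycle h)
      (hne : y.sign ≠ y'.sign) :
      Relation K (ofPath C ^ (Γ.mult (Γ.endpoint h) - 1) * ofPath p)
  /-- Type III: the paths `αβ` of length two that are not sub-paths of an sg-special cycle, except
  the squares of the loops induced by the vertices of valency one. -/
  | typeIII {x y z : Γ.SgQuiver} (α : x ⟶ y) (β : y ⟶ z)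
      (hsub : ¬ IsSubpathOfSgSpecialCycle (α.toPath.comp β.toPath))
      (hloop : ¬ IsSquareOfLoop α β) :
      Relation K (ofPath (α.toPath.comp β.toPath))

/-- The ideal of relations of the skew-Brauer graph algebra. -/
def relationIdeal (K : Type*) [Field K] [Finite E] : TwoSidedIdeal (PathAlgebra K Γ.SgQuiver) :=
  TwoSidedIdeal.span {r | Γ.Relation K r}

/-- The skew-Brauer graph algebra. -/
abbrev SkewBrauerAlgebra (K : Type*) [Field K] [Finite E] : Type _ :=
  (Γ.relationIdeal K).ringCon.Quotient

/-- No loop of the Brauer quiver is attached to a distinguished vertex of that quiver. -/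
def NoLoopAtDistinguished : Prop := ∀ x ∈ Γ.Sp, IsEmpty (x ⟶ x)

/-- If `v` is a vertex of valency two with `mult v > 1`, and one of the two edges at `v` is
distinguished, then the other edge at `v` joins `v` to a vertex `u` with
`mult u * val u = 1`. -/
def MultiplicityCondition : Prop :=
  ∀ h : E × Bool, Γ.endpoint (BrauerGraph.opp h) ∈ Γ.distinguished →
    Γ.val (Γ.endpoint h) = 2 → 1 < Γ.mult (Γ.endpoint h) →
      Γ.mult (Γ.endpoint (BrauerGraph.opp (Γ.next h))) *
        Γ.val (Γ.endpoint (BrauerGraph.opp (Γ.next h))) = 1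

end SkewBrauerGraph

end

/-! By relation (III), a path with nonzero class goes round a single vertex of the graph, so its
half-edges form a run `h, next h, ...` (`cls_eq_zero_or_exists_run`). By relation (0), its class
depends only on this run and on the two ends of the path, not on the signs passed in between
(`cls_eq_of_halves_eq`). A run longer than `socleLength h` gives zero. A run of exactly that length
gives zero unless the path is closed (relations (IIa), (IIb), (III)). Hence finitely many classes
span the algebra, which is therefore finite dimensional.

The socle length is `val * mult`, except at a vertex of valency two with a distinguished edge. There
(III) already kills `x⁺ → y → x⁻`; since interior signs can be exchanged, every path of length three
vanishes, whatever the multiplicity. If the multiplicity exceeds one, the full power of the cycle is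
zero, and (I) would force the maximal closed path at an active opposite end of the other edge to
vanish as well. The multiplicity condition rules this out (`eq_or_socleLength_eq`), and then all
maximal closed paths at one quiver vertex share one class (`cls_eq_of_closed`).

The symmetrizing form is 1 on the maximal closed paths, and on the stationary path at a quiver
vertex without arrows, and 0 on all other paths. It is a trace because rotating a maximal run gives
a maximal run. It kills the relation ideal (`relationIdeal_le_formRadical`), so it descends to the
quotient. Nondegeneracy comes from complements: a path `p` with nonzero class has a path `q`
completing it to a maximal closed path, and only paths in the class of `p` pair nontrivially with
`q` (`cls_eq_zero_or_exists_dual`). Pairing with `q` thus reads off the coefficient of that class.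
-/

noncomputable section

/-! ### Runs of successive half-edges around a vertex -/

namespace BrauerGraph

variable {V E : Type*} (Γ : BrauerGraph V E)

/-- The list of `k` successive half-edges at a vertex, starting with `h`. -/
def run (h : E × Bool) (k : ℕ) : List (E × Bool) :=
  (List.range k).map fun i => (Γ.next ^ i) h

/-- A half-edge is active when it gives arrows of the Brauer quiver. -/
def Active (h : E × Bool) : Prop :=
  2 ≤ Γ.mult (Γ.endpoint h) * Γ.val (Γ.endpoint h)

theorem specialCycle_eq_run (h : E × Bool) :
    Γ.specialCycle h = Γ.run h (Γ.val (Γ.endpoint h)) := rfl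

@[simp] theorem length_run (h : E × Bool) (k : ℕ) : (Γ.run h k).length = k := by
  simp [run]

@[simp] theorem run_zero (h : E × Bool) : Γ.run h 0 = [] := rfl

@[simp] theorem run_one (h : E × Bool) : Γ.run h 1 = [h] := rfl

theorem run_add (h : E × Bool) (a b : ℕ) :
    Γ.run h (a + b) = Γ.run h a ++ Γ.run ((Γ.next ^ a) h) b := by
  simp only [run, List.range_add, List.map_append, List.map_map]
  congr 1
  refine List.map_congr_left fun i _ => ?_
  simp [add_comm a i, pow_add]

theorem run_succ (h : E × Bool) (k : ℕ) : Γ.run h (k + 1) = h :: Γ.run (Γ.next h) k := by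
  rw [add_comm, run_add]; rfl

theorem run_succ' (h : E × Bool) (k : ℕ) :
    Γ.run h (k + 1) = Γ.run h k ++ [(Γ.next ^ k) h] := by
  rw [run_add]; rfl

theorem append_eq_run {l₁ l₂ : List (E × Bool)} {h : E × Bool} {k : ℕ}
    (H : l₁ ++ l₂ = Γ.run h k) :
    l₁ = Γ.run h l₁.length ∧ l₂ = Γ.run ((Γ.next ^ l₁.length) h) l₂.length ∧
      k = l₁.length + l₂.length := by
  have hk : k = l₁.length + l₂.length := by
    rw [← Γ.length_run h k, ← H, List.length_append]
  have := H
  rw [hk, run_add] at this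
  obtain ⟨h₁, h₂⟩ := List.append_inj this (by simp)
  exact ⟨h₁, h₂, hk⟩

theorem run_inj {h h' : E × Bool} {k k' : ℕ} (H : Γ.run h k = Γ.run h' k') (hk : 0 < k) :
    h = h' ∧ k = k' := by
  have hkk : k = k' := by simpa using congrArg List.length H
  subst hkk
  obtain ⟨k, rfl⟩ := Nat.exists_eq_succ_of_ne_zero hk.ne'
  simp only [Nat.succ_eq_add_one, run_succ] at H
  exact ⟨(List.cons.inj H).1, rfl⟩

@[simp] theorem endpoint_pow (h : E × Bool) (k : ℕ) :
    Γ.endpoint ((Γ.next ^ k) h) = Γ.endpoint h := by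
  induction k with
  | zero => rfl
  | succ k ih => rw [pow_succ', Equiv.Perm.mul_apply, Γ.endpoint_next, ih]

/-- The half-edges at a vertex form a single orbit of `next`, so the valency is the minimal period
of `next` at `h`. -/
theorem pow_val [Finite E] (h : E × Bool) : (Γ.next ^ Γ.val (Γ.endpoint h)) h = h := by
  classical
  have e : {h' : E × Bool | Γ.endpoint h' = Γ.endpoint h} =
      MulAction.orbit (Subgroup.zpowers Γ.next) h := by
    ext h'
    constructor
    · intro hh
      obtain ⟨i, hi⟩ := Γ.sameCycle_next h h' hh.symm
      exact ⟨⟨Γ.next ^ i, i, rfl⟩, hi⟩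
    · rintro ⟨⟨_, i, rfl⟩, rfl⟩
      change Γ.endpoint ((Γ.next ^ i) h) = _
      obtain ⟨n, hn⟩ := (Equiv.Perm.SameCycle.exists_nat_pow_eq (f := Γ.next) (x := h)
        (y := (Γ.next ^ i) h) ⟨i, rfl⟩)
      rw [← hn, endpoint_pow]
  have hv : Γ.val (Γ.endpoint h) = Function.minimalPeriod Γ.next h := by
    have := Fintype.ofFinite (MulAction.orbit (Subgroup.zpowers Γ.next) h)
    have h1 := MulAction.minimalPeriod_eq_card (a := Γ.next) (b := h)
    rw [← Nat.card_eq_fintype_card] at h1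
    change Nat.card {h' : E × Bool | Γ.endpoint h' = Γ.endpoint h} = _
    rw [e, ← h1]
    rfl
  have := Function.iterate_minimalPeriod (f := Γ.next) (x := h)
  rw [hv, ← Equiv.Perm.iterate_eq_pow]
  exact this

theorem pow_val_mul [Finite E] (h : E × Bool) (m : ℕ) :
    (Γ.next ^ (Γ.val (Γ.endpoint h) * m)) h = h := by
  induction m with
  | zero => rfl
  | succ m ih => rw [mul_add, pow_add, Equiv.Perm.mul_apply, mul_one, pow_val, ih]

theorem val_pos [Finite E] (h : E × Bool) : 0 < Γ.val (Γ.endpoint h) :=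
  haveI : Nonempty {h' : E × Bool // Γ.endpoint h' = Γ.endpoint h} := ⟨⟨h, rfl⟩⟩
  Nat.card_pos

theorem active_next {h : E × Bool} : Γ.Active (Γ.next h) ↔ Γ.Active h := by
  simp only [Active, Γ.endpoint_next]

theorem active_pow {h : E × Bool} (k : ℕ) : Γ.Active ((Γ.next ^ k) h) ↔ Γ.Active h := by
  simp only [Active, Γ.endpoint_pow]

theorem eq_or_eq_opp {h h' : E × Bool} (e : h.1 = h'.1) : h = h' ∨ h = opp h' := by
  obtain ⟨x, b⟩ := h
  obtain ⟨y, c⟩ := h'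
  obtain rfl : x = y := e
  cases b <;> cases c <;> simp [opp]

end BrauerGraph

/-! ### Active ends of distinguished edges -/

namespace SkewBrauerGraph

open BrauerGraph

variable {V E : Type*} {Γ : SkewBrauerGraph V E}

theorem not_active_of_distinguished {h : E × Bool} (hd : Γ.endpoint h ∈ Γ.distinguished) :
    ¬ Γ.Active h := by
  simp [Active, Γ.mult_distinguished _ hd, Γ.val_distinguished _ hd]

theorem opp_distinguished {h : E × Bool} (ha : Γ.Active h) (hs : h.1 ∈ Γ.Sp) :
    Γ.endpoint (opp h) ∈ Γ.distinguished := by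
  obtain ⟨h', e, hd⟩ := hs
  rcases eq_or_eq_opp e with rfl | rfl
  · exact absurd ha (not_active_of_distinguished hd)
  · exact hd

/-- A distinguished edge has at most one active end. -/
theorem eq_of_active_of_mem_Sp {h h' : E × Bool} (ha : Γ.Active h) (ha' : Γ.Active h')
    (e : h.1 = h'.1) (hs : h'.1 ∈ Γ.Sp) : h = h' := by
  rcases eq_or_eq_opp e with rfl | rfl
  · rfl
  · exact absurd ha (not_active_of_distinguished (opp_distinguished ha' hs))

/-! ### Vertices and arrows of the sg-quiver -/

theorem sgVertex_eq_of_notMem {x y : Γ.SgQuiver} (e : x.vertex = y.vertex)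
    (hx : x.vertex ∉ Γ.Sp) : x = y := by
  refine SgVertex.ext e ?_
  have h1 : x.sign = none := by
    rw [← Option.isNone_iff_eq_none, ← Option.not_isSome, Bool.not_eq_true']
    simpa using mt x.sign_isSome.1 hx
  have h2 : y.sign = none := by
    rw [← Option.isNone_iff_eq_none, ← Option.not_isSome, Bool.not_eq_true']
    simpa using mt y.sign_isSome.1 (e ▸ hx)
  rw [h1, h2]

theorem mem_Sp_of_ne {x y : Γ.SgQuiver} (e : x.vertex = y.vertex) (hne : x ≠ y) :
    x.vertex ∈ Γ.Sp :=
  by_contra fun h => hne (sgVertex_eq_of_notMem e h)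

theorem signs_of_ne {x y : Γ.SgQuiver} (e : x.vertex = y.vertex) (hne : x ≠ y) :
    (x.sign = some true ∧ y.sign = some false) ∨ (x.sign = some false ∧ y.sign = some true) := by
  have hx := mem_Sp_of_ne e hne
  have h1 := x.sign_isSome.2 hx
  have h2 := y.sign_isSome.2 (e ▸ hx)
  have h3 : x.sign ≠ y.sign := fun h => hne (SgVertex.ext e h)
  obtain ⟨a, ha⟩ := Option.isSome_iff_exists.1 h1
  obtain ⟨b, hb⟩ := Option.isSome_iff_exists.1 h2
  rw [ha, hb] at h3 ⊢
  cases a <;> cases b <;> simp_all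

theorem exists_sgVertex (v : Γ.QuiverVertex) : ∃ x : Γ.SgQuiver, x.vertex = v := by
  classical
  by_cases h : v ∈ Γ.Sp
  · exact ⟨⟨v, some true, by simpa using h⟩, rfl⟩
  · exact ⟨⟨v, none, by simpa using h⟩, rfl⟩

theorem exists_ne_sgVertex {x : Γ.SgQuiver} (hx : x.vertex ∈ Γ.Sp) :
    ∃ y : Γ.SgQuiver, y.vertex = x.vertex ∧ y ≠ x := by
  obtain ⟨b, hb⟩ := Option.isSome_iff_exists.1 (x.sign_isSome.2 hx)
  refine ⟨⟨x.vertex, some !b, by simpa using hx⟩, rfl, fun h => ?_⟩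
  have := congrArg SgVertex.sign h
  rw [hb] at this
  simp at this

theorem half_fst {x y : Γ.SgQuiver} (α : x ⟶ y) : (half α).1 = x.vertex :=
  Arrow.source_eq (Γ := Γ.toBrauerGraph) (x := x.vertex) (y := y.vertex) α

theorem next_half_fst {x y : Γ.SgQuiver} (α : x ⟶ y) : (Γ.next (half α)).1 = y.vertex :=
  Arrow.target_eq (Γ := Γ.toBrauerGraph) (x := x.vertex) (y := y.vertex) α

theorem active_half {x y : Γ.SgQuiver} (α : x ⟶ y) : Γ.Active (half α) :=
  Arrow.nontrivial (Γ := Γ.toBrauerGraph) (x := x.vertex) (y := y.vertex) α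

theorem half_injective {x y : Γ.SgQuiver} {α β : x ⟶ y} (h : half α = half β) : α = β :=
  Arrow.ext (Γ := Γ.toBrauerGraph) (x := x.vertex) (y := y.vertex) h

theorem exists_arrow {x y : Γ.SgQuiver} {h : E × Bool} (ha : Γ.Active h) (hx : x.vertex = h.1)
    (hy : y.vertex = (Γ.next h).1) : ∃ α : x ⟶ y, half α = h :=
  ⟨(⟨h, hx.symm, hy.symm, ha⟩ : Γ.Arrow x.vertex y.vertex), rfl⟩

@[simp] theorem halves_nil {x : Γ.SgQuiver} : halves (Quiver.Path.nil : Quiver.Path x x) = [] := rfl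

@[simp] theorem halves_cons {x y z : Γ.SgQuiver} (p : Quiver.Path x y) (α : y ⟶ z) :
    halves (p.cons α) = halves p ++ [half α] := rfl

@[simp] theorem halves_toPath {x y : Γ.SgQuiver} (α : x ⟶ y) : halves α.toPath = [half α] := rfl

@[simp] theorem halves_comp {x y z : Γ.SgQuiver} (p : Quiver.Path x y) (q : Quiver.Path y z) :
    halves (p.comp q) = halves p ++ halves q := by
  induction q with
  | nil => simp
  | cons q α ih => simp [ih]

theorem eq_of_halves_eq_nil {x y : Γ.SgQuiver} {p : Quiver.Path x y} (h : halves p = []) :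
    x = y := by
  cases p with
  | nil => rfl
  | cons p α => simp at h

/-- Lets all cutting of paths be done on lists of half-edges; only the sign of the cutting vertex is
left to the path. -/
theorem exists_split {x y : Γ.SgQuiver} (p : Quiver.Path x y) {l₁ l₂ : List (E × Bool)}
    (h : halves p = l₁ ++ l₂) :
    ∃ (z : Γ.SgQuiver) (p₁ : Quiver.Path x z) (p₂ : Quiver.Path z y),
      p = p₁.comp p₂ ∧ halves p₁ = l₁ ∧ halves p₂ = l₂ := by
  induction p generalizing l₂ with
  | nil =>
    obtain ⟨rfl, rfl⟩ := List.append_eq_nil_iff.1 h.symm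
    exact ⟨_, .nil, .nil, rfl, rfl, rfl⟩
  | cons p α ih =>
    rcases List.eq_nil_or_concat l₂ with rfl | ⟨l₂, a, rfl⟩
    · exact ⟨_, p.cons α, .nil, rfl, by simpa using h, rfl⟩
    · rw [halves_cons, List.concat_eq_append, ← List.append_assoc] at h
      obtain ⟨h1, h2⟩ := List.append_inj' h rfl
      obtain ⟨z, p₁, p₂, rfl, e₁, e₂⟩ := ih h1
      exact ⟨z, p₁, p₂.cons α, rfl, e₁, by rw [halves_cons, e₂, List.concat_eq_append, h2]⟩

theorem exists_arrow_of_halves {x y : Γ.SgQuiver} {p : Quiver.Path x y} {h : E × Bool}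
    (hp : halves p = [h]) : ∃ α : x ⟶ y, p = α.toPath ∧ half α = h := by
  cases p with
  | nil => simp at hp
  | cons p α =>
    cases p with
    | nil => exact ⟨α, rfl, by simpa using hp⟩
    | cons p β => simpa using congrArg List.length hp

theorem exists_cons_split {x y : Γ.SgQuiver} (p : Quiver.Path x y) {h : E × Bool}
    {l : List (E × Bool)} (hp : halves p = h :: l) :
    ∃ (z : Γ.SgQuiver) (α : x ⟶ z) (p₂ : Quiver.Path z y),
      p = α.toPath.comp p₂ ∧ half α = h ∧ halves p₂ = l := by
  obtain ⟨z, p₁, p₂, rfl, e₁, e₂⟩ := exists_split p (l₁ := [h]) (l₂ := l) (by simpa using hp)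
  obtain ⟨α, rfl, rfl⟩ := exists_arrow_of_halves e₁
  exact ⟨z, α, p₂, rfl, rfl, e₂⟩

theorem start_and_end_of_run {x y : Γ.SgQuiver} {p : Quiver.Path x y} {h : E × Bool} {k : ℕ}
    (hk : 0 < k) (hp : halves p = Γ.run h k) :
    Γ.Active h ∧ h.1 = x.vertex ∧ ((Γ.next ^ k) h).1 = y.vertex := by
  obtain ⟨k, rfl⟩ := Nat.exists_eq_succ_of_ne_zero hk.ne'
  obtain ⟨z, α, p₂, e, rfl, -⟩ := exists_cons_split p (hp.trans (Γ.run_succ h k))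
  refine ⟨active_half α, half_fst α, ?_⟩
  rw [Nat.succ_eq_add_one, run_succ'] at hp
  cases p with
  | nil => simp at hp
  | cons p β =>
    rw [halves_cons] at hp
    have := (List.append_inj' hp rfl).2
    rw [pow_succ', Equiv.Perm.mul_apply, ← List.cons.inj this |>.1, next_half_fst]

/-- Any two vertices of the sg-quiver over the ends of a run are joined by a path over it. -/
theorem exists_path {x y : Γ.SgQuiver} {h : E × Bool} {k : ℕ} (hk : 0 < k) (ha : Γ.Active h)
    (hx : x.vertex = h.1) (hy : y.vertex = ((Γ.next ^ k) h).1) :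
    ∃ p : Quiver.Path x y, halves p = Γ.run h k := by
  obtain ⟨k, rfl⟩ := Nat.exists_eq_succ_of_ne_zero hk.ne'
  clear hk
  induction k generalizing y with
  | zero =>
    obtain ⟨α, rfl⟩ := exists_arrow ha hx hy
    exact ⟨α.toPath, rfl⟩
  | succ k ih =>
    obtain ⟨z, hz⟩ := exists_sgVertex (Γ := Γ) ((Γ.next ^ (k + 1)) h).1
    obtain ⟨p, hp⟩ := ih hz
    obtain ⟨α, hα⟩ := exists_arrow (x := z) (y := y) ((Γ.active_pow (k + 1)).2 ha) hz
      (by rw [hy, Nat.succ_eq_add_one, pow_succ' _ (k + 1)]; rfl)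
    exact ⟨p.cons α, by rw [halves_cons, hp, hα, Nat.succ_eq_add_one, Γ.run_succ' h (k + 1)]⟩

/-! ### The length of the longest nonzero paths at a vertex -/

variable (Γ) in
/-- The vertex of `h` has valency two and one of its edges is distinguished. -/
def Degenerate (h : E × Bool) : Prop :=
  Γ.val (Γ.endpoint h) = 2 ∧ (h.1 ∈ Γ.Sp ∨ (Γ.next h).1 ∈ Γ.Sp)

open Classical in
variable (Γ) in
/-- The length of the longest nonzero paths that start with `h`. -/
def socleLength (h : E × Bool) : ℕ :=
  if Γ.Degenerate h then 2 else Γ.val (Γ.endpoint h) * Γ.mult (Γ.endpoint h)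

theorem socleLength_of_degenerate {h : E × Bool} (hd : Γ.Degenerate h) :
    Γ.socleLength h = 2 := if_pos hd

theorem socleLength_of_not_degenerate {h : E × Bool} (hd : ¬ Γ.Degenerate h) :
    Γ.socleLength h = Γ.val (Γ.endpoint h) * Γ.mult (Γ.endpoint h) := if_neg hd

theorem degenerate_next [Finite E] (h : E × Bool) :
    Γ.Degenerate (Γ.next h) ↔ Γ.Degenerate h := by
  unfold Degenerate
  rw [Γ.endpoint_next]
  refine and_congr_right fun h2 => ?_
  have := Γ.pow_val h
  rw [h2, pow_two, Equiv.Perm.mul_apply] at this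
  rw [this, or_comm]

theorem socleLength_next [Finite E] (h : E × Bool) :
    Γ.socleLength (Γ.next h) = Γ.socleLength h := by
  by_cases hd : Γ.Degenerate h
  · rw [socleLength_of_degenerate hd, socleLength_of_degenerate ((degenerate_next h).2 hd)]
  · rw [socleLength_of_not_degenerate hd,
      socleLength_of_not_degenerate (mt (degenerate_next h).1 hd), Γ.endpoint_next]

@[simp] theorem socleLength_pow [Finite E] (h : E × Bool) (k : ℕ) :
    Γ.socleLength ((Γ.next ^ k) h) = Γ.socleLength h := by
  induction k with
  | zero => rfl
  | succ k ih => rw [pow_succ', Equiv.Perm.mul_apply, socleLength_next, ih]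

theorem socleLength_le (h : E × Bool) :
    Γ.socleLength h ≤ Γ.val (Γ.endpoint h) * Γ.mult (Γ.endpoint h) := by
  unfold socleLength
  split_ifs with hd
  · rw [hd.1]
    exact Nat.le_mul_of_pos_right 2 (Γ.mult_pos _)
  · rfl

theorem two_le_socleLength {h : E × Bool} (ha : Γ.Active h) : 2 ≤ Γ.socleLength h := by
  unfold socleLength
  split_ifs with hd
  · rfl
  · rw [mul_comm]; exact ha

theorem pow_socleLength [Finite E] (h : E × Bool) : (Γ.next ^ Γ.socleLength h) h = h := by
  unfold socleLength
  split_ifs with hd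
  · have := Γ.pow_val h
    rwa [hd.1] at this
  · exact Γ.pow_val_mul h _

/-- An active half-edge alone at its vertex belongs to an edge that is not distinguished. -/
theorem notMem_Sp_of_val_eq_one [Finite E] (hloop : Γ.NoLoopAtDistinguished) {h : E × Bool}
    (ha : Γ.Active h) (h1 : Γ.val (Γ.endpoint h) = 1) : h.1 ∉ Γ.Sp := by
  intro hs
  have := Γ.pow_val h
  rw [h1, pow_one] at this
  exact (hloop _ hs).false (⟨h, rfl, by rw [this], ha⟩ : Γ.Arrow h.1 h.1)

theorem next_of_val_eq_one [Finite E] {h : E × Bool} (h1 : Γ.val (Γ.endpoint h) = 1) :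
    Γ.next h = h := by
  simpa [h1] using Γ.pow_val h

end SkewBrauerGraph

namespace SkewBrauerGraph

open BrauerGraph PathAlgebra

variable {V E : Type*} {Γ : SkewBrauerGraph V E} {K : Type*} [Field K] [Finite E]

/-! ### The classes of the paths in the skew-Brauer graph algebra -/

variable (Γ K) in
/-- The projection of the path algebra onto the skew-Brauer graph algebra. -/
def proj : PathAlgebra K Γ.SgQuiver →ₐ[K] Γ.SkewBrauerAlgebra K :=
  { (Γ.relationIdeal K).ringCon.mk' with commutes' := fun _ => rfl }

theorem proj_surjective : Function.Surjective (proj Γ K) :=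
  RingCon.mk'_surjective _

theorem proj_eq_zero_iff {a : PathAlgebra K Γ.SgQuiver} :
    proj Γ K a = 0 ↔ a ∈ Γ.relationIdeal K := by
  rw [TwoSidedIdeal.mem_iff]
  exact (Γ.relationIdeal K).ringCon.eq

theorem proj_relation {a : PathAlgebra K Γ.SgQuiver} (h : Γ.Relation K a) : proj Γ K a = 0 :=
  proj_eq_zero_iff.2 (TwoSidedIdeal.subset_span h)

variable (K) in
/-- The class of a path in the skew-Brauer graph algebra. -/
def cls {x y : Γ.SgQuiver} (p : Quiver.Path x y) : Γ.SkewBrauerAlgebra K :=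
  proj Γ K (ofPath p)

theorem cls_comp {x y z : Γ.SgQuiver} (p : Quiver.Path x y) (q : Quiver.Path y z) :
    cls K (p.comp q) = cls K p * cls K q := by
  rw [cls, ← ofPath_mul_ofPath, map_mul]; rfl

theorem cls_cons {x y z : Γ.SgQuiver} (p : Quiver.Path x y) (α : y ⟶ z) :
    cls K (p.cons α) = cls K p * cls K α.toPath :=
  cls_comp p α.toPath

theorem cls_type0 {x y y' z : Γ.SgQuiver} (α : x ⟶ y) (β : y ⟶ z) (α' : x ⟶ y') (β' : y' ⟶ z)
    (hα : half α = half α') (hβ : half β = half β') :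
    cls K (α.toPath.comp β.toPath) = cls K (α'.toPath.comp β'.toPath) := by
  have e : y.vertex = y'.vertex := by rw [← next_half_fst α, ← next_half_fst α', hα]
  by_cases hne : y = y'
  · subst hne
    rw [half_injective hα, half_injective hβ]
  · rcases signs_of_ne e hne with ⟨h1, h2⟩ | ⟨h1, h2⟩
    · have := proj_relation (K := K) (Relation.type0 α β α' β' hα hβ h1 h2)
      rwa [map_sub, sub_eq_zero] at this
    · have := proj_relation (K := K) (Relation.type0 α' β' α β hα.symm hβ.symm h2 h1)
      rw [map_sub, sub_eq_zero] at this
      exact this.symm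

/-- Parallel paths over the same arrows of the Brauer quiver have the same class. -/
theorem cls_eq_of_halves_eq {x y : Γ.SgQuiver} {p p' : Quiver.Path x y}
    (h : halves p = halves p') : cls K p = cls K p' := by
  induction p with
  | nil =>
    cases p' with
    | nil => rfl
    | cons p' α' => simp at h
  | @cons z y p β ih =>
    cases p' with
    | nil => simp at h
    | @cons z' _ p' β' =>
      simp only [halves_cons] at h
      obtain ⟨h1, h2⟩ := List.append_inj' h rfl
      have hβ : half β = half β' := (List.cons.inj h2).1
      have e : z.vertex = z'.vertex := by rw [← half_fst β, ← half_fst β', hβ]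
      by_cases hz : z = z'
      · subst hz
        rw [half_injective hβ, cls_cons, cls_cons, ih h1]
      · cases p' with
        | nil => exact absurd (eq_of_halves_eq_nil h1).symm hz
        | @cons w _ p' α' =>
          -- `z` and `z'` are the two signs of one edge: redirect the previous arrow of `p'` to `z`,
          -- use induction up to `z`, then exchange the signs by relation (0).
          obtain ⟨α, hα⟩ := exists_arrow (x := w) (y := z) (active_half α') (half_fst α').symm
            (by rw [next_half_fst, e])
          rw [cls_cons, ih (p' := p'.cons α) (by rw [h1, halves_cons, halves_cons, hα]), cls_cons,
            mul_assoc, ← cls_comp, cls_type0 α β α' β' hα hβ, cls_comp, ← mul_assoc, ← cls_cons,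
            ← cls_cons]

/-! ### Vanishing of paths -/

/-- A path of length two over two half-edges that are not successive is zero. -/
theorem cls_eq_zero_of_ne_next {x y z : Γ.SgQuiver} (α : x ⟶ y) (β : y ⟶ z)
    (h : half β ≠ Γ.next (half α)) : cls K (α.toPath.comp β.toPath) = 0 := by
  refine proj_relation (Relation.typeIII α β ?_ ?_)
  · rintro ⟨h₀, w, C, hC, a, b, rfl⟩
    simp only [IsSgSpecialCycle, specialCycle_eq_run, halves_comp, halves_toPath,
      List.append_assoc] at hC
    obtain ⟨-, h1, -⟩ := Γ.append_eq_run hC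
    simp only [List.cons_append, List.nil_append, List.length_cons, run_succ] at h1
    obtain ⟨h2, h3⟩ := List.cons.inj h1
    exact h (by rw [h2, (List.cons.inj h3).1])
  -- The exempted loop squares do follow the orientation, since valency one makes `next` fix the
  -- half-edge.
  · rintro ⟨-, -, h1, h2, -⟩
    exact h (by rw [next_of_val_eq_one h2, h1])

/-- A path that does not follow the orientation at a vertex is zero. -/
theorem cls_eq_zero_or_exists_run {x y : Γ.SgQuiver} (p : Quiver.Path x y) :
    halves p = [] ∨ cls K p = 0 ∨ ∃ h k, 0 < k ∧ halves p = Γ.run h k := by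
  induction p with
  | nil => exact .inl rfl
  | @cons y z p α ih =>
    refine .inr ?_
    rcases ih with h0 | h0 | ⟨h, k, hk, hp⟩
    · exact .inr ⟨half α, 1, one_pos, by simp [h0]⟩
    · exact .inl (by rw [cls_cons, h0, zero_mul])
    · by_cases e : half α = (Γ.next ^ k) h
      · exact .inr ⟨h, k + 1, k.succ_pos, by rw [halves_cons, hp, e, run_succ']⟩
      · refine .inl ?_
        obtain ⟨k, rfl⟩ := Nat.exists_eq_succ_of_ne_zero hk.ne'
        cases p with
        | nil => simpa using congrArg List.length hp
        | cons p β =>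
          rw [Nat.succ_eq_add_one, run_succ', halves_cons] at hp
          have hβ := (List.cons.inj (List.append_inj' hp rfl).2).1
          rw [cls_cons, cls_cons, mul_assoc, ← cls_comp, cls_eq_zero_of_ne_next, mul_zero]
          rw [hβ]
          intro h'
          exact e (by rw [h', Nat.succ_eq_add_one, pow_succ' _ k]; rfl)

/-- At a vertex of valency two, a path of length two which is not closed is zero. -/
theorem cls_eq_zero_of_val_eq_two {x y : Γ.SgQuiver} {p : Quiver.Path x y} {h : E × Bool}
    (h2 : Γ.val (Γ.endpoint h) = 2) (hp : halves p = Γ.run h 2) (hne : x ≠ y) :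
    cls K p = 0 := by
  obtain ⟨z, α, p₂, rfl, hα, hp₂⟩ := exists_cons_split p (hp.trans (Γ.run_succ h 1))
  obtain ⟨β, rfl, hβ⟩ := exists_arrow_of_halves hp₂
  refine proj_relation (Relation.typeIII α β ?_ ?_)
  -- An sg-special cycle at this vertex has length two, so it would equal the path itself and the
  -- path would be closed.
  · rintro ⟨h₀, w, C, hC, a, b, rfl⟩
    simp only [IsSgSpecialCycle, specialCycle_eq_run, halves_comp, halves_toPath,
      List.append_assoc] at hC
    obtain ⟨-, h3, h4⟩ := Γ.append_eq_run hC
    simp only [List.cons_append, List.nil_append, List.length_cons, run_succ] at h3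
    have h5 : Γ.endpoint h = Γ.endpoint h₀ := by
      rw [← hα, (List.cons.inj h3).1, endpoint_pow]
    rw [← h5, h2] at h4
    simp only [List.cons_append, List.nil_append, List.length_cons] at h4
    have ha : halves a = [] := List.length_eq_zero_iff.1 (by omega)
    have hb : halves b = [] := List.length_eq_zero_iff.1 (by omega)
    exact hne ((eq_of_halves_eq_nil ha).symm.trans (eq_of_halves_eq_nil hb).symm)
  · rintro ⟨-, -, -, h1, -⟩
    rw [hα, h2] at h1
    omega

/-- A power of a cycle, followed by a path, is a path. -/
theorem exists_path_pow_mul {y z : Γ.SgQuiver} {h : E × Bool} {C : Quiver.Path y y}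
    (hC : IsSgSpecialCycle h C) (p : Quiver.Path y z) (k : ℕ) :
    ∃ D : Quiver.Path y z, (ofPath C ^ k * ofPath p : PathAlgebra K Γ.SgQuiver) = ofPath D ∧
      halves D = Γ.run h (Γ.val (Γ.endpoint h) * k) ++ halves p := by
  induction k with
  | zero => exact ⟨p, by rw [pow_zero, one_mul], rfl⟩
  | succ k ih =>
    obtain ⟨D, hD, hD'⟩ := ih
    refine ⟨C.comp D, by rw [pow_succ', mul_assoc, hD, ofPath_mul_ofPath], ?_⟩
    rw [halves_comp, hD', show halves C = _ from hC, specialCycle_eq_run, ← List.append_assoc]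
    congr 1
    rw [mul_add, mul_one, add_comm (_ * k), run_add, pow_val]

theorem exists_path_pow {y : Γ.SgQuiver} {h : E × Bool} {C : Quiver.Path y y}
    (hC : IsSgSpecialCycle h C) {k : ℕ} (hk : 0 < k) :
    ∃ D : Quiver.Path y y, (ofPath C ^ k : PathAlgebra K Γ.SgQuiver) = ofPath D ∧
      halves D = Γ.run h (Γ.val (Γ.endpoint h) * k) := by
  obtain ⟨k, rfl⟩ := Nat.exists_eq_succ_of_ne_zero hk.ne'
  obtain ⟨D, hD, hD'⟩ := exists_path_pow_mul (K := K) hC C k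
  refine ⟨D, by rw [← hD, Nat.succ_eq_add_one, pow_succ], ?_⟩
  rw [hD', show halves C = _ from hC, specialCycle_eq_run, Nat.succ_eq_add_one, mul_add, mul_one,
    run_add, pow_val_mul]

/-- Every arrow is the first arrow of an sg-special cycle. -/
theorem exists_specialCycle_cons (hloop : Γ.NoLoopAtDistinguished) {x z : Γ.SgQuiver} (α : x ⟶ z) :
    ∃ p : Quiver.Path z x, IsSgSpecialCycle (half α) (α.toPath.comp p) := by
  have key : ∃ p : Quiver.Path z x,
      halves p = Γ.run (Γ.next (half α)) (Γ.val (Γ.endpoint (half α)) - 1) := by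
    -- In valency one the remainder of the cycle is empty, so the arrow itself must be closed. This
    -- is where loops at distinguished edges must be excluded: an arrow `x⁺ → x⁻` would start no
    -- sg-special cycle.
    by_cases h1 : Γ.val (Γ.endpoint (half α)) = 1
    · have hx := notMem_Sp_of_val_eq_one hloop (active_half α) h1
      rw [half_fst] at hx
      obtain rfl : x = z := sgVertex_eq_of_notMem
        (by rw [← next_half_fst α, next_of_val_eq_one h1, half_fst]) hx
      exact ⟨.nil, by rw [h1]; rfl⟩
    · have h0 := Γ.val_pos (half α)
      refine exists_path (by omega) (Γ.active_next.2 (active_half α)) (next_half_fst α).symm ?_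
      rw [← Equiv.Perm.mul_apply, ← pow_succ, Nat.sub_add_cancel h0, pow_val, half_fst]
  obtain ⟨p, hp⟩ := key
  refine ⟨p, ?_⟩
  rw [IsSgSpecialCycle, specialCycle_eq_run, halves_comp, hp, halves_toPath, List.singleton_append,
    ← run_succ, Nat.sub_add_cancel (Γ.val_pos _)]

/-- A path that goes around a vertex for too long is zero. -/
theorem cls_eq_zero_of_socleLength_lt (hloop : Γ.NoLoopAtDistinguished) {x y : Γ.SgQuiver}
    {p : Quiver.Path x y} {h : E × Bool} {k : ℕ} (hp : halves p = Γ.run h k)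
    (hk : Γ.socleLength h < k) : cls K p = 0 := by
  obtain ⟨j, rfl⟩ := Nat.exists_eq_add_of_lt hk
  -- It suffices to kill the initial segment of length `socleLength h + 1`.
  rw [add_right_comm, run_add] at hp
  obtain ⟨z, p, p₂, rfl, hp, -⟩ := exists_split p hp
  rw [cls_comp]
  suffices cls K p = 0 by rw [this, zero_mul]
  obtain ⟨ha, hx, hz⟩ := start_and_end_of_run (Nat.succ_pos _) hp
  rw [Nat.succ_eq_add_one, pow_succ', Equiv.Perm.mul_apply, pow_socleLength] at hz
  by_cases hd : Γ.Degenerate h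
  · rw [socleLength_of_degenerate hd] at hp
    have h2 : (Γ.next ^ 2) h = h := by simpa [hd.1] using Γ.pow_val h
    -- Length three: exchange the sign of the interior vertex over the distinguished edge so that
    -- the first (resp. last) two arrows form a non-closed path, which relation (III) kills.
    rcases hd.2 with hs | hs
    · rw [hx] at hs
      obtain ⟨w, hw, hne⟩ := exists_ne_sgVertex hs
      obtain ⟨a, ha'⟩ := exists_path (x := x) (y := w) two_pos ha hx.symm (by rw [h2, hw, hx])
      obtain ⟨c, hc⟩ := exists_path (x := w) (y := z) one_pos ha (by rw [hw, hx]) hz.symm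
      rw [cls_eq_of_halves_eq (p' := a.comp c) (by rw [hp, run_add, halves_comp, ha', hc, h2]),
        cls_comp, cls_eq_zero_of_val_eq_two hd.1 ha' hne.symm, zero_mul]
    · rw [hz] at hs
      obtain ⟨w, hw, hne⟩ := exists_ne_sgVertex hs
      obtain ⟨a, ha'⟩ := exists_path (x := x) (y := w) one_pos ha hx.symm (by rw [hw, ← hz]; rfl)
      obtain ⟨c, hc⟩ := exists_path (x := w) (y := z) two_pos (Γ.active_next.2 ha)
        (by rw [hw, hz]) (by rw [← hz, ← Equiv.Perm.mul_apply, ← pow_succ, pow_succ',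
          Equiv.Perm.mul_apply, h2])
      have hv : Γ.val (Γ.endpoint (Γ.next h)) = 2 := by rw [Γ.endpoint_next, hd.1]
      rw [cls_eq_of_halves_eq (p' := a.comp c)
          (by rw [hp, add_comm, run_add, halves_comp, ha', hc, pow_one]),
        cls_comp, cls_eq_zero_of_val_eq_two hv hc hne, mul_zero]
  -- The path has the same ends and half-edges as the path in relation (IIa) whose first and last
  -- arrow are both `α`.
  · obtain ⟨α, rfl⟩ := exists_arrow ha hx.symm hz.symm
    obtain ⟨q, hC⟩ := exists_specialCycle_cons hloop α
    obtain ⟨D, hD, hD'⟩ := exists_path_pow_mul (K := K) hC α.toPath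
      (Γ.mult (Γ.endpoint (half α)))
    have := proj_relation (K := K) (Relation.typeIIa (half α) _ hC α q rfl)
    rw [hD] at this
    rw [← this, ← cls]
    refine cls_eq_of_halves_eq ?_
    rw [hp, hD', run_succ', pow_socleLength, socleLength_of_not_degenerate hd, halves_toPath]

/-- A path of maximal length that is not closed is zero. -/
theorem cls_eq_zero_of_ne {x y : Γ.SgQuiver} {p : Quiver.Path x y} {h : E × Bool}
    (hp : halves p = Γ.run h (Γ.socleLength h)) (hne : x ≠ y) : cls K p = 0 := by
  have hpos : 0 < Γ.socleLength h :=
    Nat.pos_of_ne_zero fun h0 => hne (eq_of_halves_eq_nil (p := p) (by rw [hp, h0]; rfl))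
  obtain ⟨ha, hx, hy⟩ := start_and_end_of_run hpos hp
  rw [pow_socleLength] at hy
  by_cases hd : Γ.Degenerate h
  · rw [socleLength_of_degenerate hd] at hp
    exact cls_eq_zero_of_val_eq_two hd.1 hp hne
  · have e : x.vertex = y.vertex := hx.symm.trans hy
    obtain ⟨C, hC⟩ := exists_path (x := x) (y := x) (Γ.val_pos h) ha hx.symm
      (by rw [pow_val, hx])
    obtain ⟨q, hq⟩ := exists_path (x := x) (y := y) (Γ.val_pos h) ha hx.symm
      (by rw [pow_val, hy])
    -- The ends are the two signs of one distinguished edge, so `C ^ (mult - 1)` followed by `q` is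
    -- a relation (IIb) over the same half-edges as `p`.
    obtain ⟨D, hD, hD'⟩ := exists_path_pow_mul (K := K) (h := h) (C := C) hC q
      (Γ.mult (Γ.endpoint h) - 1)
    have := proj_relation (K := K) (Relation.typeIIb h C hC (mem_Sp_of_ne e hne) q hq
      fun h' => hne (SgVertex.ext e h'))
    rw [hD] at this
    rw [← this, ← cls]
    refine cls_eq_of_halves_eq ?_
    have hm : Γ.mult (Γ.endpoint h) = Γ.mult (Γ.endpoint h) - 1 + 1 :=
      (Nat.sub_add_cancel (Γ.mult_pos _)).symm
    rw [hp, hD', socleLength_of_not_degenerate hd, hq]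
    conv_lhs => rw [hm, mul_add, mul_one, run_add, pow_val_mul]

/-! ### Closed paths of maximal length -/

/-- If the socle length at `h` is shortened, then `h` is the only active end of its edge: either the
edge is distinguished, or the multiplicity condition makes its other end inactive. So relation (I)
between two different active ends only compares paths of full length. -/
theorem eq_or_socleLength_eq (hMC : Γ.MultiplicityCondition) {h h' : E × Bool} (ha : Γ.Active h)
    (ha' : Γ.Active h') (e : h'.1 = h.1) :
    h' = h ∨ Γ.socleLength h = Γ.val (Γ.endpoint h) * Γ.mult (Γ.endpoint h) := by
  by_cases hd : Γ.Degenerate h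
  · by_cases hm : Γ.mult (Γ.endpoint h) = 1
    · exact .inr (by rw [socleLength_of_degenerate hd, hd.1, hm])
    · refine .inl ?_
      rcases hd.2 with hs | hs
      · exact eq_of_active_of_mem_Sp ha' ha e hs
      -- The condition is stated from the distinguished edge, here that of `next h`; its successor
      -- is `h` again.
      · have h2 := hMC (Γ.next h) (opp_distinguished (Γ.active_next.2 ha) hs)
        have h3 : Γ.next (Γ.next h) = h := by
          have := Γ.pow_val h
          rwa [hd.1, pow_two] at this
        rw [Γ.endpoint_next, h3] at h2
        have h4 := h2 hd.1 (lt_of_le_of_ne (Γ.mult_pos _) (Ne.symm hm))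
        rcases eq_or_eq_opp e with rfl | rfl
        · rfl
        · simp [Active, h4] at ha'
  · exact .inr (socleLength_of_not_degenerate hd)

theorem cls_eq_of_eq_run {x : Γ.SgQuiver} {C p : Quiver.Path x x} {h : E × Bool}
    (hC : IsSgSpecialCycle h C)
    (hp : halves p = Γ.run h (Γ.val (Γ.endpoint h) * Γ.mult (Γ.endpoint h))) :
    cls K p = proj Γ K (ofPath C ^ Γ.mult (Γ.endpoint h)) := by
  obtain ⟨D, hD, hD'⟩ := exists_path_pow (K := K) hC (Γ.mult_pos (Γ.endpoint h))
  rw [hD, ← cls]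
  exact cls_eq_of_halves_eq (hp.trans hD'.symm)

/-- The class of a closed path of maximal length depends only on the vertex where it starts. -/
theorem cls_eq_of_closed (hMC : Γ.MultiplicityCondition) {x : Γ.SgQuiver}
    {p p' : Quiver.Path x x} {h h' : E × Bool} (ha : Γ.Active h) (ha' : Γ.Active h')
    (hp : halves p = Γ.run h (Γ.socleLength h)) (hp' : halves p' = Γ.run h' (Γ.socleLength h')) :
    cls K p = cls K p' := by
  have hx := (start_and_end_of_run (two_pos.trans_le (two_le_socleLength ha)) hp).2.1
  have hx' := (start_and_end_of_run (two_pos.trans_le (two_le_socleLength ha')) hp').2.1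
  have e : h'.1 = h.1 := hx'.trans hx.symm
  by_cases hh : h' = h
  · subst hh
    exact cls_eq_of_halves_eq (hp.trans hp'.symm)
  · rw [(eq_or_socleLength_eq hMC ha ha' e).resolve_left hh] at hp
    rw [(eq_or_socleLength_eq hMC ha' ha e.symm).resolve_left (Ne.symm hh)] at hp'
    obtain ⟨C, hC⟩ := exists_path (x := x) (y := x) (Γ.val_pos h) ha hx.symm (by rw [pow_val, hx])
    obtain ⟨C', hC'⟩ := exists_path (x := x) (y := x) (Γ.val_pos h') ha' hx'.symm
      (by rw [pow_val, hx'])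
    rw [cls_eq_of_eq_run hC hp, cls_eq_of_eq_run hC' hp', ← sub_eq_zero, ← map_sub]
    exact proj_relation (Relation.typeI h h' C C' hC hC')

end SkewBrauerGraph

namespace SkewBrauerGraph

open BrauerGraph PathAlgebra

variable {V E : Type*} {Γ : SkewBrauerGraph V E} {K : Type*} [Field K]

/-! ### The symmetrizing form -/

variable (Γ) in
/-- The half-edges of a closed path of maximal length, or no half-edge when the path is stationary
at an isolated vertex of the quiver. -/
def IsSocleList (v : Γ.QuiverVertex) (l : List (E × Bool)) : Prop :=
  (∃ h, Γ.Active h ∧ l = Γ.run h (Γ.socleLength h)) ∨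
    (l = [] ∧ ∀ h : E × Bool, h.1 = v → ¬ Γ.Active h)

variable (Γ) in
/-- The closed paths on which the symmetrizing form is one. -/
def IsSocle : TotalPath Γ.SgQuiver → Prop
  | ⟨x, y, p⟩ => x = y ∧ Γ.IsSocleList x.vertex (halves p)

open Classical in
variable (Γ K) in
/-- The symmetrizing form on the path algebra. -/
def form : PathAlgebra K Γ.SgQuiver →ₗ[K] K :=
  basis.constr K fun p => if Γ.IsSocle p then 1 else 0

open Classical in
theorem form_ofPath {x y : Γ.SgQuiver} (p : Quiver.Path x y) :
    form Γ K (ofPath p) = if x = y ∧ Γ.IsSocleList x.vertex (halves p) then 1 else 0 := by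
  rw [form, ofPath, single, Module.Basis.constr_basis]
  exact if_congr Iff.rfl rfl rfl

theorem form_eq_zero {x y : Γ.SgQuiver} {p : Quiver.Path x y}
    (h : x = y → ¬ Γ.IsSocleList x.vertex (halves p)) : form Γ K (ofPath p) = 0 := by
  rw [form_ofPath, if_neg (by tauto)]

/-- The first half-edge of a maximal run determines its length. -/
theorem not_isSocleList_run_append {v : Γ.QuiverVertex} {h : E × Bool} {k : ℕ}
    {l : List (E × Bool)} (hk : 0 < k) (hlt : Γ.socleLength h < k + l.length) :
    ¬ Γ.IsSocleList v (Γ.run h k ++ l) := by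
  rintro (⟨h', -, e⟩ | ⟨e, -⟩)
  · obtain ⟨h1, -, h3⟩ := Γ.append_eq_run e
    obtain ⟨rfl, -⟩ := Γ.run_inj h1 hk
    rw [length_run] at h3
    omega
  · have := congrArg List.length e
    simp at this
    omega

variable [Finite E]

/-- Since `next ^ socleLength h` fixes `h`, a rotated maximal run is the maximal run from a later
half-edge. The hypothesis `hvw` serves the stationary case, the only one in which the vertex
matters. -/
theorem isSocleList_rotate {v w : Γ.QuiverVertex} {l₁ l₂ : List (E × Bool)}
    (h : Γ.IsSocleList v (l₁ ++ l₂)) (hvw : l₁ = [] → w = v) : Γ.IsSocleList w (l₂ ++ l₁) := by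
  rcases h with ⟨h, ha, e⟩ | ⟨e, h⟩
  · obtain ⟨h1, h2, h3⟩ := Γ.append_eq_run e
    refine .inl ⟨(Γ.next ^ l₁.length) h, (Γ.active_pow _).2 ha, ?_⟩
    rw [socleLength_pow, h3, add_comm, run_add, ← h2, ← Equiv.Perm.mul_apply, ← pow_add,
      add_comm, ← h3, pow_socleLength, ← h1]
  · obtain ⟨rfl, rfl⟩ := List.append_eq_nil_iff.1 e
    exact .inr ⟨rfl, by rwa [hvw rfl]⟩

theorem form_mul_comm_ofPath {x y z w : Γ.SgQuiver} (p : Quiver.Path x y) (q : Quiver.Path z w) :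
    form Γ K (ofPath p * ofPath q) = form Γ K (ofPath q * ofPath p) := by
  classical
  by_cases h1 : y = z <;> by_cases h2 : w = x
  · subst h1 h2
    rw [ofPath_mul_ofPath, ofPath_mul_ofPath, form_ofPath, form_ofPath, halves_comp, halves_comp]
    refine if_congr ⟨fun h => ⟨rfl, isSocleList_rotate h.2 fun e => ?_⟩,
      fun h => ⟨rfl, isSocleList_rotate h.2 fun e => ?_⟩⟩ rfl rfl
    · rw [eq_of_halves_eq_nil e]
    · rw [eq_of_halves_eq_nil e]
  · subst h1
    rw [ofPath_mul_ofPath, ofPath_mul_ofPath_of_ne h2, map_zero]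
    exact form_eq_zero fun e => absurd e.symm h2
  · subst h2
    rw [ofPath_mul_ofPath_of_ne h1, ofPath_mul_ofPath, map_zero]
    exact (form_eq_zero fun e => absurd e.symm h1).symm
  · rw [ofPath_mul_ofPath_of_ne (K := K) h1, ofPath_mul_ofPath_of_ne (K := K) h2]

theorem form_mul_comm (a b : PathAlgebra K Γ.SgQuiver) :
    form Γ K (a * b) = form Γ K (b * a) := by
  have : (mulLinear (K := K) (Q := Γ.SgQuiver)).compr₂ (form Γ K) =
      (mulLinear (K := K) (Q := Γ.SgQuiver)).flip.compr₂ (form Γ K) := by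
    refine hom_ext fun p => hom_ext fun q => ?_
    exact form_mul_comm_ofPath (K := K) p.2.2 q.2.2
  exact LinearMap.congr_fun (LinearMap.congr_fun this a) b

/-! ### The form vanishes on the relations -/

theorem form_typeI (hMC : Γ.MultiplicityCondition) {y z : Γ.SgQuiver} {h h' : E × Bool}
    {p p' : Quiver.Path y y} (q : Quiver.Path y z)
    (ha : Γ.Active h) (ha' : Γ.Active h')
    (hp : halves p = Γ.run h (Γ.val (Γ.endpoint h) * Γ.mult (Γ.endpoint h)))
    (hp' : halves p' = Γ.run h' (Γ.val (Γ.endpoint h') * Γ.mult (Γ.endpoint h'))) :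
    form Γ K (ofPath (p.comp q)) = form Γ K (ofPath (p'.comp q)) := by
  classical
  have hpos : ∀ h : E × Bool, 0 < Γ.val (Γ.endpoint h) * Γ.mult (Γ.endpoint h) :=
    fun h => Nat.mul_pos (Γ.val_pos h) (Γ.mult_pos _)
  have e : h'.1 = h.1 := (start_and_end_of_run (hpos h') hp').2.1.trans
    (start_and_end_of_run (hpos h) hp).2.1.symm
  rw [form_ofPath, form_ofPath, halves_comp, halves_comp, hp, hp']
  by_cases hh : h' = h
  · rw [hh]
  have h1 := (eq_or_socleLength_eq hMC ha ha' e).resolve_left hh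
  have h2 := (eq_or_socleLength_eq hMC ha' ha e.symm).resolve_left (Ne.symm hh)
  by_cases hq : halves q = []
  · rw [hq, List.append_nil, List.append_nil]
    exact if_congr (and_congr_right fun _ => iff_of_true (.inl ⟨h, ha, by rw [h1]⟩)
      (.inl ⟨h', ha', by rw [h2]⟩)) rfl rfl
  · have := List.length_pos_iff.2 hq
    rw [if_neg fun H => not_isSocleList_run_append (hpos h) (by omega) H.2,
      if_neg fun H => not_isSocleList_run_append (hpos h') (by omega) H.2]

theorem active_of_isSgSpecialCycle {y : Γ.SgQuiver} {h : E × Bool} {C : Quiver.Path y y}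
    (hC : IsSgSpecialCycle h C) : Γ.Active h :=
  (start_and_end_of_run (Γ.val_pos h) hC).1

/-- If the path were maximal and closed, `α` and `β` would be successive at a vertex. In valency
one, `αβ` is then an exempted loop square; in valency two, it is closed, hence an sg-special cycle;
in larger valency, it extends to one. Each case contradicts a hypothesis. -/
theorem form_typeIII (hloop : Γ.NoLoopAtDistinguished) {x y z : Γ.SgQuiver} (α : x ⟶ y) (β : y ⟶ z)
    (hsub : ¬ IsSubpathOfSgSpecialCycle (α.toPath.comp β.toPath)) (hsq : ¬ IsSquareOfLoop α β)
    {w : Γ.SgQuiver} (q : Quiver.Path z w) :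
    form Γ K (ofPath ((α.toPath.comp β.toPath).comp q)) = 0 := by
  refine form_eq_zero ?_
  rintro rfl (⟨h, ha, e⟩ | ⟨e, -⟩)
  swap
  · simpa using congrArg List.length e
  rw [halves_comp] at e
  obtain ⟨h1, -, h3⟩ := Γ.append_eq_run e
  have hl : (halves (α.toPath.comp β.toPath)).length = 2 := by simp
  rw [hl] at h1 h3
  have h12 := h1
  rw [halves_comp, halves_toPath, halves_toPath, run_succ, run_one, List.singleton_append] at h12
  obtain ⟨hα, hβ⟩ := List.cons.inj h12
  have hβ := (List.cons.inj hβ).1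
  obtain ⟨-, hx, hz⟩ := start_and_end_of_run two_pos h1
  have hcl : x = z → Γ.val (Γ.endpoint h) ≠ 2 := by
    rintro rfl h2
    exact hsub ⟨h, x, _, by rw [IsSgSpecialCycle, specialCycle_eq_run, h2]; exact h1, .nil, .nil,
      by rw [Quiver.Path.nil_comp, Quiver.Path.comp_nil]⟩
  have hv0 := Γ.val_pos h
  rcases (show Γ.val (Γ.endpoint h) = 1 ∨ Γ.val (Γ.endpoint h) = 2 ∨ 2 < Γ.val (Γ.endpoint h) by
    omega) with hv | hv | hv
  · have hs := notMem_Sp_of_val_eq_one hloop ha hv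
    have hn := next_of_val_eq_one hv
    rw [hn] at hβ
    rw [pow_two, Equiv.Perm.mul_apply, hn, hn] at hz
    have hy := next_half_fst α
    rw [hα, hn] at hy
    rw [hx] at hs
    have hxy : x = y := sgVertex_eq_of_notMem (hx.symm.trans hy) hs
    have hxz : x = z := sgVertex_eq_of_notMem (hx.symm.trans hz) hs
    refine hsq ⟨hxy, hxy.symm.trans hxz, hα.trans hβ.symm, by rw [hα, hv], ?_⟩
    rw [hα]
    unfold Active at ha
    rw [hv] at ha
    omega
  · have h2 : (Γ.next ^ 2) h = h := by simpa [hv] using Γ.pow_val h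
    rw [h2] at hz
    refine hcl ?_ hv
    -- In the degenerate case the socle length two leaves no room for `q`; otherwise no edge at the
    -- vertex is distinguished, so the ends have no signs to differ by.
    by_cases hd : Γ.Degenerate h
    · rw [socleLength_of_degenerate hd] at h3
      exact (eq_of_halves_eq_nil (List.length_eq_zero_iff.1 (by omega : (halves q).length = 0))).symm
    · exact sgVertex_eq_of_notMem (hx.symm.trans hz)
        fun hs => hd ⟨hv, .inl (by rw [hx]; exact hs)⟩
  · obtain ⟨r, hr⟩ := exists_path (x := z) (y := x) (h := (Γ.next ^ 2) h)
      (k := Γ.val (Γ.endpoint h) - 2) (by omega) ((Γ.active_pow 2).2 ha) hz.symm (by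
        rw [← Equiv.Perm.mul_apply, ← pow_add, Nat.sub_add_cancel hv.le, pow_val, hx])
    refine hsub ⟨h, x, (α.toPath.comp β.toPath).comp r, ?_, .nil, r, by rw [Quiver.Path.nil_comp]⟩
    rw [IsSgSpecialCycle, specialCycle_eq_run, halves_comp, h1, hr, ← run_add,
      Nat.add_sub_cancel' hv.le]

/-- (0) leaves ends and half-edges unchanged, (I) compares two paths of maximal length, and (IIa) is
already too long. (IIb) ends at the wrong sign, so closing it up takes further arrows and makes it
too long. -/
theorem form_relation_mul_ofPath (hloop : Γ.NoLoopAtDistinguished) (hMC : Γ.MultiplicityCondition)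
    {r : PathAlgebra K Γ.SgQuiver} (hr : Γ.Relation K r) {z w : Γ.SgQuiver}
    (q : Quiver.Path z w) : form Γ K (r * ofPath q) = 0 := by
  classical
  cases hr with
  | @type0 x y y' z' αp βp αm βm hα hβ hy hy' =>
    rw [sub_mul, map_sub, sub_eq_zero]
    by_cases e : z' = z
    · subst e
      rw [ofPath_mul_ofPath, ofPath_mul_ofPath, form_ofPath, form_ofPath]
      simp only [halves_comp, halves_toPath, hα, hβ]
    · rw [ofPath_mul_ofPath_of_ne e, ofPath_mul_ofPath_of_ne e]
  | @typeI y h h' C C' hC hC' =>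
    obtain ⟨D, hD, hD'⟩ := exists_path_pow (K := K) hC (Γ.mult_pos (Γ.endpoint h))
    obtain ⟨F, hF, hF'⟩ := exists_path_pow (K := K) hC' (Γ.mult_pos (Γ.endpoint h'))
    rw [hD, hF, sub_mul, map_sub, sub_eq_zero]
    by_cases e : y = z
    · subst e
      rw [ofPath_mul_ofPath, ofPath_mul_ofPath]
      exact form_typeI hMC q (active_of_isSgSpecialCycle hC) (active_of_isSgSpecialCycle hC')
        hD' hF'
    · rw [ofPath_mul_ofPath_of_ne e, ofPath_mul_ofPath_of_ne e]
  | @typeIIa y z' h C hC α p hα =>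
    obtain ⟨D, hD, hD'⟩ := exists_path_pow_mul (K := K) hC α.toPath (Γ.mult (Γ.endpoint h))
    rw [hD]
    by_cases e : z' = z
    · subst e
      rw [ofPath_mul_ofPath]
      refine form_eq_zero fun _ => ?_
      rw [halves_comp, hD', List.append_assoc]
      refine not_isSocleList_run_append (Nat.mul_pos (Γ.val_pos h) (Γ.mult_pos _)) ?_
      have := Γ.socleLength_le h
      simp only [halves_toPath, List.length_append, List.length_singleton]
      omega
    · rw [ofPath_mul_ofPath_of_ne e, map_zero]
  | @typeIIb y y' h C hC hy p hp hne =>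
    obtain ⟨D, hD, hD'⟩ := exists_path_pow_mul (K := K) hC p (Γ.mult (Γ.endpoint h) - 1)
    rw [hD]
    have hD'' : halves D = Γ.run h (Γ.val (Γ.endpoint h) * Γ.mult (Γ.endpoint h)) := by
      have hm : Γ.mult (Γ.endpoint h) = Γ.mult (Γ.endpoint h) - 1 + 1 :=
        (Nat.sub_add_cancel (Γ.mult_pos _)).symm
      rw [hD', hp, specialCycle_eq_run]
      conv_rhs => rw [hm, mul_add, mul_one, run_add, pow_val_mul]
    by_cases e : y' = z
    · subst e
      rw [ofPath_mul_ofPath]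
      refine form_eq_zero fun hcl => ?_
      rw [halves_comp, hD'']
      refine not_isSocleList_run_append (Nat.mul_pos (Γ.val_pos h) (Γ.mult_pos _)) ?_
      have h1 := Γ.socleLength_le h
      have h2 : 0 < (halves q).length := by
        refine List.length_pos_iff.2 fun h0 => hne ?_
        rw [hcl, eq_of_halves_eq_nil h0]
      omega
    · rw [ofPath_mul_ofPath_of_ne e, map_zero]
  | @typeIII x y z' α β hsub hsq =>
    by_cases e : z' = z
    · subst e
      rw [ofPath_mul_ofPath]
      exact form_typeIII hloop α β hsub hsq q
    · rw [ofPath_mul_ofPath_of_ne e, map_zero]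

theorem form_relation_mul (hloop : Γ.NoLoopAtDistinguished) (hMC : Γ.MultiplicityCondition)
    {r : PathAlgebra K Γ.SgQuiver} (hr : Γ.Relation K r) (b : PathAlgebra K Γ.SgQuiver) :
    form Γ K (r * b) = 0 := by
  have : (form Γ K).comp (mulLinear r) = 0 :=
    hom_ext fun p => form_relation_mul_ofPath hloop hMC hr p.2.2
  exact LinearMap.congr_fun this b

variable (Γ K) in
/-- The radical of the symmetrizing form. -/
def formRadical : TwoSidedIdeal (PathAlgebra K Γ.SgQuiver) :=
  TwoSidedIdeal.mk' {a | ∀ b, form Γ K (a * b) = 0}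
    (fun b => by rw [zero_mul, map_zero])
    (fun {x y} hx hy b => by rw [add_mul, map_add, hx b, hy b, add_zero])
    (fun {x} hx b => by rw [neg_mul, map_neg, hx b, neg_zero])
    -- The trace property turns the right ideal into a two-sided one.
    (fun {x y} hy b => by rw [mul_assoc, form_mul_comm, mul_assoc]; exact hy _)
    (fun {x y} hx b => by rw [mul_assoc]; exact hx _)

theorem mem_formRadical {a : PathAlgebra K Γ.SgQuiver} :
    a ∈ formRadical Γ K ↔ ∀ b, form Γ K (a * b) = 0 := by
  simp [formRadical, TwoSidedIdeal.mem_mk']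

theorem relationIdeal_le_formRadical (hloop : Γ.NoLoopAtDistinguished)
    (hMC : Γ.MultiplicityCondition) : Γ.relationIdeal K ≤ formRadical Γ K :=
  TwoSidedIdeal.span_le.2 fun _ hr => mem_formRadical.2 (form_relation_mul hloop hMC hr)

/-! ### Finite dimension and nondegeneracy -/

theorem eq_of_form_mul_ne_zero {u v y x : Γ.SgQuiver} {p : Quiver.Path u v} {q : Quiver.Path y x}
    (h : form Γ K (ofPath p * ofPath q) ≠ 0) :
    u = x ∧ v = y ∧ Γ.IsSocleList x.vertex (halves p ++ halves q) := by
  by_cases e : v = y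
  · subst e
    rw [ofPath_mul_ofPath] at h
    have h1 : u = x ∧ Γ.IsSocleList u.vertex (halves (p.comp q)) := by
      by_contra hn
      exact h (form_eq_zero fun h1 h2 => hn ⟨h1, h2⟩)
    obtain ⟨rfl, h1⟩ := h1
    exact ⟨rfl, rfl, by rwa [halves_comp] at h1⟩
  · rw [ofPath_mul_ofPath_of_ne e, map_zero] at h
    exact absurd rfl h

/-- A list of half-edges followed by a nonempty run is maximal only if it is the complement of
that run. -/
theorem eq_run_of_isSocleList_append {v : Γ.QuiverVertex} {l : List (E × Bool)} {h : E × Bool}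
    {k j : ℕ} (hj : 0 < j) (hkj : k + j = Γ.socleLength h)
    (H : Γ.IsSocleList v (l ++ Γ.run ((Γ.next ^ k) h) j)) : l = Γ.run h k := by
  rcases H with ⟨h', -, e⟩ | ⟨e, -⟩
  · obtain ⟨h1, h2, h3⟩ := Γ.append_eq_run e
    -- The nonempty run fixes the position on the orbit of `next`, hence the socle length, the
    -- length of `l`, and its first half-edge.
    obtain ⟨h4, -⟩ := Γ.run_inj h2 hj
    have h5 : Γ.socleLength h' = Γ.socleLength h := by
      rw [← socleLength_pow h' l.length, ← h4, socleLength_pow]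
    rw [length_run] at h3
    have h6 : l.length = k := by omega
    rw [h6] at h1 h4
    rw [h1, (Γ.next ^ k).injective h4]
  · have := congrArg List.length e
    simp at this
    omega

/-- The class of a path is zero, or the path has a complement for the symmetrizing form which
determines its class. -/
theorem cls_eq_zero_or_exists_dual (hloop : Γ.NoLoopAtDistinguished)
    (hMC : Γ.MultiplicityCondition) {x y : Γ.SgQuiver} (p : Quiver.Path x y) :
    cls K p = 0 ∨ ∃ q : Quiver.Path y x, form Γ K (ofPath p * ofPath q) = 1 ∧
      ∀ (u v : Γ.SgQuiver) (p' : Quiver.Path u v),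
        form Γ K (ofPath p' * ofPath q) ≠ 0 → cls K p' = cls K p := by
  classical
  rcases cls_eq_zero_or_exists_run (K := K) p with hp | hp | ⟨h, k, hk, hp⟩
  · obtain rfl := eq_of_halves_eq_nil hp
    refine .inr ?_
    by_cases hiso : ∀ h : E × Bool, h.1 = x.vertex → ¬ Γ.Active h
    · refine ⟨.nil, ?_, fun u v p' hp' => ?_⟩
      · rw [ofPath_mul_ofPath, form_ofPath, if_pos ⟨rfl, .inr ⟨by simpa using hp, hiso⟩⟩]
      · obtain ⟨rfl, rfl, H⟩ := eq_of_form_mul_ne_zero hp'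
        rw [halves_nil, List.append_nil] at H
        rcases H with ⟨h, ha, e⟩ | ⟨e, -⟩
        · exact absurd ha (hiso h
            (start_and_end_of_run (two_pos.trans_le (two_le_socleLength ha)) e).2.1)
        · exact cls_eq_of_halves_eq (e.trans hp.symm)
    · push Not at hiso
      obtain ⟨h, hx, ha⟩ := hiso
      have hpos := two_pos.trans_le (two_le_socleLength ha)
      -- The complement of a stationary path is a maximal closed path starting with an active end.
      obtain ⟨q, hq⟩ := exists_path (x := x) (y := x) hpos ha hx.symm (by rw [pow_socleLength, hx])
      refine ⟨q, ?_, fun u v p' hp' => ?_⟩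
      · rw [ofPath_mul_ofPath, form_ofPath, if_pos]
        exact ⟨rfl, .inl ⟨h, ha, by rw [halves_comp, hp, hq, List.nil_append]⟩⟩
      · obtain ⟨rfl, rfl, H⟩ := eq_of_form_mul_ne_zero hp'
        rw [hq] at H
        exact cls_eq_of_halves_eq ((eq_run_of_isSocleList_append (k := 0) hpos (zero_add _) H).trans
          hp.symm)
  · exact .inl hp
  · obtain ⟨ha, hx, hy⟩ := start_and_end_of_run hk hp
    rcases lt_trichotomy (Γ.socleLength h) k with hlt | rfl | hlt
    · exact .inl (cls_eq_zero_of_socleLength_lt hloop hp hlt)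
    · by_cases e : x = y
      · subst e
        -- A maximal path is its own completion. Every maximal closed path at `x` pairs with the
        -- stationary path, so uniqueness of their class, and with it `hMC`, is needed here.
        refine .inr ⟨.nil, ?_, fun u v p' hp' => ?_⟩
        · rw [ofPath_mul_ofPath, form_ofPath, if_pos ⟨rfl, .inl ⟨h, ha, by simpa using hp⟩⟩]
        · obtain ⟨rfl, rfl, H⟩ := eq_of_form_mul_ne_zero hp'
          rw [halves_nil, List.append_nil] at H
          rcases H with ⟨h', ha', e⟩ | ⟨-, hiso⟩
          · exact cls_eq_of_closed hMC ha' ha e hp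
          · exact absurd ha (hiso h hx)
      · exact .inl (cls_eq_zero_of_ne hp e)
    · refine .inr ?_
      obtain ⟨j, hj⟩ := Nat.exists_eq_add_of_lt hlt
      -- The complement is the rest of the maximal run from `h`, of length `socleLength h - k = j +
      -- 1`.
      obtain ⟨q, hq⟩ := exists_path (x := y) (y := x) (k := j + 1) j.succ_pos
        ((Γ.active_pow k).2 ha) hy.symm (by
          rw [← Equiv.Perm.mul_apply, ← pow_add, add_comm, ← add_assoc, ← hj, pow_socleLength, hx])
      refine ⟨q, ?_, fun u v p' hp' => ?_⟩
      · rw [ofPath_mul_ofPath, form_ofPath, if_pos]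
        exact ⟨rfl, .inl ⟨h, ha, by rw [halves_comp, hp, hq, ← run_add, ← add_assoc, ← hj]⟩⟩
      · obtain ⟨rfl, rfl, H⟩ := eq_of_form_mul_ne_zero hp'
        rw [hq] at H
        exact cls_eq_of_halves_eq
          ((eq_run_of_isSocleList_append j.succ_pos (by omega) H).trans hp.symm)

theorem exists_forall_length_le (hloop : Γ.NoLoopAtDistinguished) :
    ∃ N : ℕ, ∀ (x y : Γ.SgQuiver) (p : Quiver.Path x y),
      cls K p ≠ 0 → (halves p).length ≤ N := by
  obtain ⟨N, hN⟩ := (Set.finite_range Γ.socleLength).bddAbove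
  refine ⟨N, fun x y p hne => ?_⟩
  rcases cls_eq_zero_or_exists_run (K := K) p with hp | hp | ⟨h, k, hk, hp⟩
  · simp [hp]
  · exact absurd hp hne
  · rw [hp, length_run]
    by_contra hlt
    exact hne (cls_eq_zero_of_socleLength_lt hloop hp
      ((hN ⟨h, rfl⟩).trans_lt (not_le.1 hlt)))

/-- A nonzero class is determined by two vertices and a list of half-edges of bounded length, which
leaves finitely many choices. -/
theorem finite_range_cls (hloop : Γ.NoLoopAtDistinguished) :
    (Set.range fun p : TotalPath Γ.SgQuiver => cls K p.2.2).Finite := by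
  classical
  obtain ⟨N, hN⟩ := exists_forall_length_le (K := K) hloop
  let g : Γ.SgQuiver × Γ.SgQuiver × List (E × Bool) → Γ.SkewBrauerAlgebra K := fun t =>
    if h : ∃ p : Quiver.Path t.1 t.2.1, halves p = t.2.2 then cls K h.choose else 0
  have hT : (Set.univ ×ˢ (Set.univ ×ˢ {l | l.length ≤ N}) :
      Set (Γ.SgQuiver × Γ.SgQuiver × List (E × Bool))).Finite :=
    Set.finite_univ.prod (Set.finite_univ.prod (List.finite_length_le _ N))
  refine ((hT.image g).insert 0).subset ?_
  rintro _ ⟨⟨x, y, p⟩, rfl⟩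
  by_cases h0 : cls K p = 0
  · exact .inl h0
  · refine .inr ⟨(x, y, halves p), ⟨trivial, trivial, hN x y p h0⟩, ?_⟩
    have h : ∃ p' : Quiver.Path x y, halves p' = halves p := ⟨p, rfl⟩
    exact (dif_pos h).trans (cls_eq_of_halves_eq h.choose_spec)

theorem span_range_cls :
    Submodule.span K (Set.range fun p : TotalPath Γ.SgQuiver => cls K p.2.2) = ⊤ := by
  have h1 := congrArg (Submodule.map (proj Γ K).toLinearMap)
    (basis (K := K) (Q := Γ.SgQuiver)).span_eq
  rw [Submodule.map_span, Submodule.map_top, ← Set.range_comp,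
    LinearMap.range_eq_top.2 (proj_surjective (Γ := Γ) (K := K))] at h1
  exact h1

theorem finiteDimensional (hloop : Γ.NoLoopAtDistinguished) :
    FiniteDimensional K (Γ.SkewBrauerAlgebra K) :=
  ⟨Submodule.fg_def.2 ⟨_, finite_range_cls hloop, span_range_cls⟩⟩

/-! ### Descent of the form and nondegeneracy -/

theorem form_mul_congr (hloop : Γ.NoLoopAtDistinguished) (hMC : Γ.MultiplicityCondition)
    {a a' : PathAlgebra K Γ.SgQuiver} (h : proj Γ K a = proj Γ K a')
    (b : PathAlgebra K Γ.SgQuiver) : form Γ K (a * b) = form Γ K (a' * b) := by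
  rw [← sub_eq_zero, ← map_sub] at h ⊢
  rw [← sub_mul]
  exact mem_formRadical.1
    (relationIdeal_le_formRadical hloop hMC (proj_eq_zero_iff.1 h)) b

theorem form_congr (hloop : Γ.NoLoopAtDistinguished) (hMC : Γ.MultiplicityCondition)
    {a a' : PathAlgebra K Γ.SgQuiver} (h : proj Γ K a = proj Γ K a') :
    form Γ K a = form Γ K a' := by
  simpa using form_mul_congr hloop hMC h 1

/-- The coefficient of `a` at the class of a path `p` that has the dual `q`. -/
theorem sum_filter_eq_form [DecidableEq (Γ.SkewBrauerAlgebra K)] {x y : Γ.SgQuiver}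
    (hloop : Γ.NoLoopAtDistinguished) (hMC : Γ.MultiplicityCondition)
    {p : Quiver.Path x y} {q : Quiver.Path y x} (hq1 : form Γ K (ofPath p * ofPath q) = 1)
    (hq : ∀ (u v : Γ.SgQuiver) (p' : Quiver.Path u v),
        form Γ K (ofPath p' * ofPath q) ≠ 0 → cls K p' = cls K p)
    (a : PathAlgebra K Γ.SgQuiver) :
    ∑ p' ∈ (basis.repr a).support with cls K p'.2.2 = cls K p, basis.repr a p' =
      form Γ K (a * ofPath q) := by
  have e : form Γ K (a * ofPath q) =
      ∑ p' ∈ (basis.repr a).support, basis.repr a p' * form Γ K (single p' * ofPath q) := by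
    conv_lhs => rw [← basis.linearCombination_repr a, Finsupp.linearCombination_apply,
      Finsupp.sum, Finset.sum_mul, map_sum]
    refine Finset.sum_congr rfl fun p' _ => ?_
    rw [smul_mul_assoc, map_smul, smul_eq_mul]
    rfl
  rw [e, Finset.sum_filter]
  refine Finset.sum_congr rfl fun p' _ => ?_
  change _ = _ * form Γ K (ofPath p'.2.2 * ofPath q)
  -- Paths in the class of `p` pair with `q` to 1 because the form descends to the quotient; all
  -- others pair to 0.
  split_ifs with h
  · rw [form_mul_congr hloop hMC (show proj Γ K (ofPath p'.2.2) = proj Γ K (ofPath p) from h), hq1,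
      mul_one]
  · rw [not_imp_comm.1 (hq _ _ p'.2.2) h, mul_zero]

/-- Collect the paths of `a` by class: each nonzero class has a complement `q`, and its total
coefficient is the value of the form on `a * ofPath q`. -/
theorem proj_eq_zero_of_form (hloop : Γ.NoLoopAtDistinguished) (hMC : Γ.MultiplicityCondition)
    {a : PathAlgebra K Γ.SgQuiver} (h : ∀ b, form Γ K (a * b) = 0) : proj Γ K a = 0 := by
  classical
  have e : proj Γ K a = ∑ p ∈ (basis.repr a).support, basis.repr a p • cls K p.2.2 := by
    conv_lhs => rw [← basis.linearCombination_repr a, Finsupp.linearCombination_apply,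
      Finsupp.sum, map_sum]
    exact Finset.sum_congr rfl fun p _ => map_smul (proj Γ K) _ _
  rw [e, ← Finset.sum_fiberwise_of_maps_to (t := (basis.repr a).support.image
    fun p => cls K p.2.2) (g := fun p => cls K p.2.2) fun p hp => Finset.mem_image_of_mem _ hp]
  refine Finset.sum_eq_zero fun s hs => ?_
  obtain ⟨⟨x, y, p⟩, -, rfl⟩ := Finset.mem_image.1 hs
  rw [Finset.sum_congr rfl fun p' hp' => by rw [(Finset.mem_filter.1 hp').2], ← Finset.sum_smul]
  rcases cls_eq_zero_or_exists_dual (K := K) hloop hMC p with h0 | ⟨q, hq1, hq⟩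
  · exact (congrArg _ h0).trans (smul_zero _)
  · rw [sum_filter_eq_form hloop hMC hq1 hq, h, zero_smul]

/-- The form on the quotient is the form of any linear lift; `form_congr` makes the choice of the
section `s` irrelevant. -/
theorem isSymmetric (hloop : Γ.NoLoopAtDistinguished) (hMC : Γ.MultiplicityCondition) :
    IsSymmetricFiniteDimensionalAlgebra K (Γ.SkewBrauerAlgebra K) := by
  obtain ⟨s, hs⟩ := (proj Γ K).toLinearMap.exists_rightInverse_of_surjective
    (LinearMap.range_eq_top.2 proj_surjective)
  have hφ (a : PathAlgebra K Γ.SgQuiver) : (form Γ K).comp s (proj Γ K a) = form Γ K a :=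
    form_congr hloop hMC (LinearMap.congr_fun hs _)
  refine ⟨finiteDimensional hloop, (form Γ K).comp s, fun a b => ?_, fun a h => ?_⟩
  · obtain ⟨a, rfl⟩ := proj_surjective a
    obtain ⟨b, rfl⟩ := proj_surjective b
    rw [← map_mul, ← map_mul, hφ, hφ, form_mul_comm]
  · obtain ⟨a, rfl⟩ := proj_surjective a
    refine proj_eq_zero_of_form hloop hMC fun b => ?_
    rw [← hφ, map_mul, h]

end SkewBrauerGraph

end

theorem theorem4 {K V E : Type*} [Field K] [Finite E] (Γ : SkewBrauerGraph V E)
    (hloop : Γ.NoLoopAtDistinguished) :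
    FiniteDimensional K (Γ.SkewBrauerAlgebra K) ∧
      (Γ.MultiplicityCondition → IsSymmetricFiniteDimensionalAlgebra K (Γ.SkewBrauerAlgebra K)) :=
  ⟨SkewBrauerGraph.finiteDimensional hloop, SkewBrauerGraph.isSymmetric hloop⟩
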